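/- Let $\mathbb F$ be $\mathbb R$ or $\mathbb C$, let $T>0$ and let $g:\mathbb R\to\mathbb R$ be a derivator, that is, a non-decreasing left-continuous function, with $g(0)=0$ and $g$ continuous at $0$. **Notation.** $\Delta^+g(t)=g(t^+)-g(t)$, $D_g=\{t:\Delta^+g(t)>0\}$; $\mu_g$ is the Lebesgue–Stieltjes measure with $\mu_g([c,d))=g(d)-g(c)$, $\mu$ is Lebesgue measure, and $\mathcal L^1_g([0,c);\mathbb F)$ is the set of $\mu_g$-integrable functions $[0,c)\to\mathbb F$. The jump part of $g$ is $g^B(t)=\sum_{s\in[0,t)\cap D_g}\Delta^+g(s)$ for $t>0$ and $g^B(t)=-\sum_{s\in[t,0)\cap D_g}\Delta^+g(s)$ for $t\le 0$; its continuous part is $g^C=g-g^B$; and $\gamma(x)=\min\{t\in[0,T]:g^C(t)=x\}$ for $x\in[0,g^C(T)]$. A function $f:[0,c]\to\mathbb F$ belongs to $\mathcal{AC}_g([0,c];\mathbb F)$ if for every $\varepsilon>0$ there is $\delta>0$ such that $\sum_i|f(r_i)-f(l_i)|<\varepsilon$ for every finite family of pairwise disjoint open subintervals $(l_i,r_i)$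 of $[0,c]$ with $\sum_i(g(r_i)-g(l_i))<\delta$. The $g$-derivative is $f'_g(t)=\lim_{s\to t^+}\frac{f(s)-f(t)}{g(s)-g(t)}$ if $t\in D_g$, and otherwise $f'_g(t)=\lim_{s\to t}\frac{f(s)-f(t)}{g(s)-g(t)}$ over $s\in[0,c]$ with $g(s)\ne g(t)$; it is not defined at points near which $g$ is constant, and these form a $\mu_g$-null set. For $c>0$ and $\beta\in\mathcal L^1_g([0,c);\mathbb F)$, the $g$-exponential $\exp_g(\beta;0,\cdot)$ on $[0,c]$ is the solution $v\in\mathcal{AC}_g([0,c];\mathbb F)$ of $$v'_g(t)=\beta(t)v(t)\quad\text{for }\mu_g\text{-a.e. }t\in[0,c),\qquad v(0)=1 .$$ **Statement.** Let $\beta\in\mathcal L^1_g([0,T);\mathbb F)$. Then $\exp_g(\beta;0,\cdot)$ is well defined on $[0,T]$ (the solution exists and is unique), and the following hold. 1. Let $a=\operatorname{Re}\beta$ and $b=\operatorname{Im}\beta$. For every $t\in[0,T]$, the functions $a\circ\gamma$ and $b\circ\gamma$ are Lebesgue integrable on $[0,g^C(t))$, the product below converges unconditionally, and $$\exp_g(\beta;0,t)=\prod_{u\in[0,t)\cap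 D_g}\bigl(1+a(u)\Delta^+g(u)+i\,b(u)\Delta^+g(u)\bigr)\exp\Bigl(\int_{[0,g^C(t))}(a\circ\gamma)\,\mathrm d\mu\Bigr)\Bigl[\cos\Bigl(\int_{[0,g^C(t))}(b\circ\gamma)\,\mathrm d\mu\Bigr)+i\sin\Bigl(\int_{[0,g^C(t))}(b\circ\gamma)\,\mathrm d\mu\Bigr)\Bigr].$$ (If $\mathbb F=\mathbb R$, then $b=0$ and the terms containing $i$ are absent.) 2. $\overline{\exp_g(\beta;0,t)}=\exp_g(\overline\beta;0,t)$ for every $t\in[0,T]$. 3. For every integer $n\ge2$ let $p_n(\beta)(t)=n\beta(t)+\sum_{k=2}^n\binom nk\beta(t)^k\Delta^+g(t)^{k-1}$. Then $p_n(\beta)\in\mathcal L^1_g([0,T);\mathbb F)$, $\exp_g(p_n(\beta);0,\cdot)\in\mathcal{AC}_g([0,T];\mathbb F)$ and $\exp_g(\beta;0,t)^n=\exp_g(p_n(\beta);0,t)$ for every $t\in[0,T]$. 4. Let $t^0_\beta$ be the least $t\in[0,T)\cap D_g$ with $1+\beta(t)\Delta^+g(t)=0$ if such a point exists, and $t^0_\beta=T$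 otherwise. For every integer $n\ge2$ let $$q_n(\beta)(t)=-\frac{p_n(\beta)(t)}{1+p_n(\beta)(t)\,\Delta^+g(t)}.$$ Then $q_n(\beta)\in\mathcal L^1_g([0,t^0_\beta);\mathbb F)$, and, with $\exp_g(q_n(\beta);0,\cdot)$ taken on $[0,t^0_\beta]$, one has $\exp_g(q_n(\beta);0,\cdot)\in\mathcal{AC}_g([0,t^0_\beta];\mathbb F)$, and, for every $t\in[0,t^0_\beta]$, $\exp_g(\beta;0,t)\ne0$ and $\exp_g(\beta;0,t)^{-n}=\exp_g(q_n(\beta);0,t)$. Moreover $\exp_g(\beta;0,t)=0$ for every $t\in(t^0_\beta,T]$. 5. If $\beta_1,\beta_2\in\mathcal L^1_g([0,T);\mathbb F)$ and $\beta_1\beta_2\Delta^+g\in\mathcal L^1_g([0,T);\mathbb F)$, then for every $t\in[0,T]$ $$\exp_g(\beta_1;0,t)\exp_g(\beta_2;0,t)=\exp_g(\beta_1+\beta_2+\beta_1\beta_2\Delta^+g;0,t).$$ -/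

import Mathlib

open Set Filter Topology MeasureTheory

/-- A derivator: a non-decreasing, left-continuous function `g : ℝ → ℝ`. -/
structure Derivator where
  toFun : ℝ → ℝ
  mono : Monotone toFun
  leftCont : ∀ t, ContinuousWithinAt toFun (Iic t) t

namespace Derivator

instance : CoeFun Derivator (fun _ => ℝ → ℝ) := ⟨Derivator.toFun⟩

/-- The jump `Δ⁺g(t) = g(t⁺) - g(t)`. -/
noncomputable def jump (g : Derivator) (t : ℝ) : ℝ := Function.rightLim g t - g t

/-- The set `D_g` of discontinuity points of `g`. -/
def D (g : Derivator) : Set ℝ := {t | 0 < g.jump t}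

/-- The Lebesgue–Stieltjes measure `μ_g`, for which `μ_g([c, d)) = g(d) - g(c)`. It is the measure
of the right-continuous modification `t ↦ g(t⁺)` of `g`. -/
noncomputable def measure (g : Derivator) : Measure ℝ := g.mono.stieltjesFunction.measure

theorem measure_Ico (g : Derivator) (c d : ℝ) :
    g.measure (Ico c d) = ENNReal.ofReal (g d - g c) := by
  have key : ∀ t, Function.leftLim g.mono.stieltjesFunction t = g t := by
    intro t
    have h1 : Function.leftLim g t = g t :=
      leftLim_eq_of_tendsto
        ((g.leftCont t).mono_left (nhdsWithin_mono t Iio_subset_Iic_self))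
    apply le_antisymm
    · refine le_of_tendsto (g.mono.stieltjesFunction.mono.tendsto_leftLim t) ?_
      filter_upwards [self_mem_nhdsWithin] with s hs
      exact g.mono.rightLim_le hs
    · rw [← h1]
      refine le_of_tendsto_of_tendsto (g.mono.tendsto_leftLim t)
        (g.mono.stieltjesFunction.mono.tendsto_leftLim t) ?_
      filter_upwards with s
      exact g.mono.le_rightLim le_rfl
  rw [measure, StieltjesFunction.measure_Ico, key, key]

/-- The jump part `g^B` of `g`, based at `0`. -/
noncomputable def jumpPart (g : Derivator) (t : ℝ) : ℝ :=
  open Classical in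
  if 0 < t then ∑' s : ↥(Ico 0 t ∩ g.D), g.jump s else -∑' s : ↥(Ico t 0 ∩ g.D), g.jump s

/-- The continuous part `g^C = g - g^B` of `g`. -/
noncomputable def contPart (g : Derivator) (t : ℝ) : ℝ := g t - g.jumpPart t

/-- The pseudo-inverse `γ(x) = min {t ∈ [0, T] : g^C(t) = x}` of `g^C` on `[0, g^C(T)]`. -/
noncomputable def pseudoInv (g : Derivator) (T x : ℝ) : ℝ :=
  sInf {t | t ∈ Icc 0 T ∧ g.contPart t = x}

variable {𝕜 : Type*} [RCLike 𝕜]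

/-- `f ∈ AC_g([a, b]; 𝕜)`: absolute continuity of `f` with respect to `g` on `[a, b]`. -/
def AbsCont (g : Derivator) (a b : ℝ) (f : ℝ → 𝕜) : Prop :=
  ∀ ε : ℝ, 0 < ε → ∃ δ : ℝ, 0 < δ ∧ ∀ (m : ℕ) (l r : Fin m → ℝ),
    (∀ i, a ≤ l i ∧ l i < r i ∧ r i ≤ b) →
    (Pairwise fun i j => Disjoint (Ioo (l i) (r i)) (Ioo (l j) (r j))) →
    ∑ i, (g (r i) - g (l i)) < δ → ∑ i, ‖f (r i) - f (l i)‖ < ε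

/-- The filter along which `s` tends to `t` in the Stieltjes derivative at `t` of a function on
`[0, T]`: `s → t⁺` if `t ∈ D_g`, and otherwise `s → t` through the points `s` of `[0, T]` with
`g(s) ≠ g(t)`, where the difference quotient is defined. So the limit is automatically
one-sided if `g` is constant on one side of `t`. -/
noncomputable def derivFilter (g : Derivator) (T t : ℝ) : Filter ℝ :=
  open Classical in
  if t ∈ g.D then 𝓝[Ioc t T] t else 𝓝[{s | s ∈ Icc 0 T ∧ g s ≠ g t}] t

/-- `f : [0, T] → 𝕜` is `g`-differentiable at `t` with `f'_g(t) = L`. The filter is required to be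
nontrivial, so there is no derivative at points near which `g` is constant; these
form a `μ_g`-null set. -/
def HasDerivAt (g : Derivator) (T : ℝ) (f : ℝ → 𝕜) (L : 𝕜) (t : ℝ) : Prop :=
  (g.derivFilter T t).NeBot ∧
    Tendsto (fun s => (f s - f t) / ((g s - g t : ℝ) : 𝕜)) (g.derivFilter T t) (𝓝 L)

/-- `v ∈ AC_g([0, T]; 𝕜)` solves `v'_g(t) = β(t) v(t)` for `g`-a.e. `t ∈ [0, T)`, `v(0) = 1`. -/
structure IsExp (g : Derivator) (T : ℝ) (β v : ℝ → 𝕜) : Prop where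
  absCont : g.AbsCont 0 T v
  init : v 0 = 1
  deriv : ∀ᵐ t ∂(g.measure.restrict (Ico 0 T)), g.HasDerivAt T v (β t * v t) t

/-- The `g`-exponential `exp_g(β; 0, ·)` on `[0, T]`: the solution of the initial value problem
`IsExp` (only its values on `[0, T]` are meaningful). -/
noncomputable def exp (g : Derivator) (T : ℝ) (β : ℝ → 𝕜) : ℝ → 𝕜 :=
  Classical.epsilon fun v => g.IsExp T β v

/-- `p_n(β) = n β + ∑_{k=2}^n (n choose k) β^k (Δ⁺g)^{k-1}`. -/
noncomputable def p (g : Derivator) (n : ℕ) (β : ℝ → 𝕜) (t : ℝ) : 𝕜 :=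
  n * β t + ∑ k ∈ Finset.Icc 2 n, (n.choose k : 𝕜) * β t ^ k * (g.jump t : 𝕜) ^ (k - 1)

/-- `q_n(β) = -p_n(β) / (1 + p_n(β) Δ⁺g)`. -/
noncomputable def q (g : Derivator) (n : ℕ) (β : ℝ → 𝕜) (t : ℝ) : 𝕜 :=
  -(g.p n β t) / (1 + g.p n β t * (g.jump t : 𝕜))

/-- `T_β^0`: the points `t ∈ [0, T) ∩ D_g` with `1 + β(t) Δ⁺g(t) = 0`. -/
def zeroSet (g : Derivator) (T : ℝ) (β : ℝ → 𝕜) : Set ℝ :=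
  {t | t ∈ Ico 0 T ∩ g.D ∧ 1 + β t * (g.jump t : 𝕜) = 0}

/-- `t_β^0`: the least element of `T_β^0` if that set is nonempty (it is finite when `β` is
`μ_g`-integrable on `[0, T)`), and `T` otherwise. -/
noncomputable def firstZero (g : Derivator) (T : ℝ) (β : ℝ → 𝕜) : ℝ :=
  open Classical in
  if (g.zeroSet T β).Nonempty then sInf (g.zeroSet T β) else T

end Derivator

/-! The proof rests on the set function E(S) = ∏_{u ∈ S ∩ D}(1 + β(u)Δ⁺g(u)) · exp(∫_{S \ D} β
dμ_g), called `expFactor`. It is multiplicative over disjoint sets (`expFactor_union`) and, with M =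
∫_S |β| dμ_g, satisfies |E(S) - 1 - ∫_S β dμ_g| ≤ e^M - 1 - M (`expClose_expFactor`). Hence t ↦
E([0,t)) is absolutely continuous, and away from jumps its increments are E([0,t)) times those of
∫β, up to an error quadratic in the increments of ∫|β|. The g-derivative is therefore βE at every
point where both integrals are g-differentiable with the expected derivative, which is almost every
point by the fundamental theorem of calculus (`ae_hasDerivAt_integral`). That theorem is Lebesgue's
differentiation theorem transported by a generalized inverse of g, which carries Lebesgue measure to
μ_g.

Uniqueness is a Grönwall argument based on a mean value inequality (`AbsCont.norm_sub_le_integral`):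
the difference of two solutions cannot leave zero, since just after the last zero its supremum would
be at most half of itself.

Once exp_g(β; 0, t) = E([0,t)), most of the theorem is algebra. If β₃ = β₁ + β₂ + β₁β₂Δ⁺g, then 1 +
β₃Δ⁺g = (1 + β₁Δ⁺g)(1 + β₂Δ⁺g) at jumps and β₃ = β₁ + β₂ elsewhere, so the factors multiply. For
this operation p_n(β) is the n-th power of β and q_n(β) is the inverse of p_n(β). The explicit
formula follows because γ carries Lebesgue measure to the part of μ_g off D; conjugation follows
from uniqueness. -/

namespace Derivator

/-! ### Jumps, atoms of μ_g and absolute continuity -/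

section Basic

variable (g : Derivator)

theorem leftLim_stieltjesFunction (t : ℝ) :
    Function.leftLim g.mono.stieltjesFunction t = g t := by
  have h1 : Function.leftLim g t = g t :=
    leftLim_eq_of_tendsto
      ((g.leftCont t).mono_left (nhdsWithin_mono t Iio_subset_Iic_self))
  apply le_antisymm
  · refine le_of_tendsto (g.mono.stieltjesFunction.mono.tendsto_leftLim t) ?_
    filter_upwards [self_mem_nhdsWithin] with s hs
    exact g.mono.rightLim_le hs
  · rw [← h1]
    refine le_of_tendsto_of_tendsto (g.mono.tendsto_leftLim t)
      (g.mono.stieltjesFunction.mono.tendsto_leftLim t) ?_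
    filter_upwards with s
    exact g.mono.le_rightLim le_rfl

theorem measure_singleton (t : ℝ) : g.measure {t} = ENNReal.ofReal (g.jump t) := by
  rw [measure, StieltjesFunction.measure_singleton, leftLim_stieltjesFunction, jump,
    Monotone.stieltjesFunction_eq]

theorem jump_nonneg (t : ℝ) : 0 ≤ g.jump t := sub_nonneg.2 (g.mono.le_rightLim le_rfl)

theorem measureReal_singleton (t : ℝ) : g.measure.real {t} = g.jump t := by
  rw [Measure.real, measure_singleton, ENNReal.toReal_ofReal (g.jump_nonneg t)]

variable {g} in
theorem jump_eq_zero {t : ℝ} (ht : t ∉ g.D) : g.jump t = 0 :=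
  le_antisymm (not_lt.1 ht) (g.jump_nonneg t)

theorem tendsto_nhdsGT (t : ℝ) : Tendsto g (𝓝[>] t) (𝓝 (g t + g.jump t)) := by
  have := g.mono.tendsto_rightLim t
  simpa [jump] using this

variable {g} in
theorem continuousAt_of_notMem_D {t : ℝ} (ht : t ∉ g.D) : ContinuousAt g t := by
  rw [continuousAt_iff_continuous_left'_right']
  refine ⟨(g.leftCont t).mono Iio_subset_Iic_self, ?_⟩
  have := g.tendsto_nhdsGT t
  rw [jump_eq_zero ht, add_zero] at this
  exact this

theorem notMem_D_of_continuousAt {t : ℝ} (ht : ContinuousAt g t) : t ∉ g.D := by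
  have h1 := tendsto_nhds_unique (g.tendsto_nhdsGT t) (ht.mono_left nhdsWithin_le_nhds)
  intro h
  have h2 : 0 < g.jump t := h
  linarith

theorem countable_D : g.D.Countable := by
  refine g.mono.countable_not_continuousAt.mono ?_
  intro t ht hc
  exact g.notMem_D_of_continuousAt hc ht

theorem measurableSet_D : MeasurableSet g.D := g.countable_D.measurableSet

theorem measurable_jump : Measurable g.jump := by
  unfold jump
  have : Measurable fun t => g.mono.stieltjesFunction t := g.mono.stieltjesFunction.mono.measurable
  simp only [Monotone.stieltjesFunction_eq] at this
  exact this.sub g.mono.measurable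

instance : IsLocallyFiniteMeasure g.measure := by
  unfold measure; infer_instance

theorem measureReal_Ico {c d : ℝ} (h : c ≤ d) : g.measure.real (Ico c d) = g d - g c := by
  rw [Measure.real, measure_Ico, ENNReal.toReal_ofReal (sub_nonneg.2 (g.mono h))]

theorem measure_Ico_ne_top (c d : ℝ) : g.measure (Ico c d) ≠ ⊤ := by
  rw [measure_Ico]; exact ENNReal.ofReal_ne_top

end Basic

variable {𝕜 : Type*} [RCLike 𝕜] {g : Derivator} {a b : ℝ} {f h : ℝ → 𝕜}

namespace AbsCont

theorem exists_forall_lt (hf : g.AbsCont a b f) {ε : ℝ} (hε : 0 < ε) :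
    ∃ δ : ℝ, 0 < δ ∧ ∀ l r, a ≤ l → l < r → r ≤ b → g r - g l < δ → ‖f r - f l‖ < ε := by
  obtain ⟨δ, hδ, H⟩ := hf ε hε
  refine ⟨δ, hδ, fun l r hl hlr hr hlt => ?_⟩
  have := H 1 (fun _ => l) (fun _ => r) (fun _ => ⟨hl, hlr, hr⟩)
    (fun i j hij => absurd (Subsingleton.elim i j) hij)
  simpa [hlt] using this

theorem eq_of_eq (hf : g.AbsCont a b f) {l r : ℝ} (hl : a ≤ l) (hlr : l ≤ r) (hr : r ≤ b)
    (h : g l = g r) : f l = f r := by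
  rcases hlr.eq_or_lt with rfl | hlr
  · rfl
  by_contra hne
  have h0 : 0 < ‖f r - f l‖ := norm_pos_iff.2 (sub_ne_zero.2 (Ne.symm hne))
  obtain ⟨δ, hδ, H⟩ := hf.exists_forall_lt h0
  exact lt_irrefl _ (H l r hl hlr hr (by rw [h]; simpa using hδ))

theorem tendsto_left (hf : g.AbsCont a b f) {t : ℝ} (ht : a < t) (htb : t ≤ b) :
    Tendsto f (𝓝[<] t) (𝓝 (f t)) := by
  rw [Metric.tendsto_nhds]
  intro ε hε
  obtain ⟨δ, hδ, H⟩ := hf.exists_forall_lt hε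
  have h1 : Tendsto g (𝓝[<] t) (𝓝 (g t)) := (g.leftCont t).mono Iio_subset_Iic_self
  filter_upwards [h1.eventually (lt_mem_nhds (sub_lt_self (g t) hδ)), self_mem_nhdsWithin,
    Ioo_mem_nhdsLT ht] with s hs hst hs2
  rw [dist_comm, dist_eq_norm]
  exact H s t hs2.1.le hst htb (by linarith)

theorem sub (hf : g.AbsCont a b f) (hh : g.AbsCont a b h) :
    g.AbsCont a b (fun t => f t - h t) := by
  intro ε hε
  obtain ⟨δ₁, hδ₁, H₁⟩ := hf (ε / 2) (half_pos hε)
  obtain ⟨δ₂, hδ₂, H₂⟩ := hh (ε / 2) (half_pos hε)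
  refine ⟨min δ₁ δ₂, lt_min hδ₁ hδ₂, fun m l r h1 h2 h3 => ?_⟩
  have e1 := H₁ m l r h1 h2 (h3.trans_le (min_le_left _ _))
  have e2 := H₂ m l r h1 h2 (h3.trans_le (min_le_right _ _))
  calc ∑ i, ‖f (r i) - h (r i) - (f (l i) - h (l i))‖
      ≤ ∑ i, (‖f (r i) - f (l i)‖ + ‖h (r i) - h (l i)‖) := by
        refine Finset.sum_le_sum fun i _ => ?_
        rw [sub_sub_sub_comm]
        exact norm_sub_le _ _
    _ < ε := by rw [Finset.sum_add_distrib]; linarith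

theorem conj (hf : g.AbsCont a b f) : g.AbsCont a b (fun t => (starRingEnd 𝕜) (f t)) := by
  intro ε hε
  obtain ⟨δ, hδ, H⟩ := hf ε hε
  refine ⟨δ, hδ, fun m l r h1 h2 h3 => ?_⟩
  have := H m l r h1 h2 h3
  simpa only [← map_sub, RCLike.norm_conj] using this

end AbsCont

/-- A common point of the half-open intervals would have common points of the open ones just to its
right. This matters because μ_g may have atoms at left endpoints. -/
theorem disjoint_Ico_of_disjoint_Ioo {l r l' r' : ℝ}
    (h : Disjoint (Ioo l r) (Ioo l' r')) : Disjoint (Ico l r) (Ico l' r') := by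
  rw [Set.disjoint_left]
  rintro x ⟨a1, a2⟩ ⟨b1, b2⟩
  obtain ⟨y, hy1, hy2⟩ := exists_between (lt_min a2 b2)
  exact Set.disjoint_left.1 h ⟨a1.trans_lt hy1, hy2.trans_le (min_le_left _ _)⟩
    ⟨b1.trans_lt hy1, hy2.trans_le (min_le_right _ _)⟩

theorem measure_iUnion_Ico {m : ℕ} {l r : Fin m → ℝ} (h1 : ∀ i, l i < r i)
    (h2 : Pairwise fun i j => Disjoint (Ioo (l i) (r i)) (Ioo (l j) (r j))) :
    g.measure (⋃ i, Ico (l i) (r i)) = ENNReal.ofReal (∑ i, (g (r i) - g (l i))) := by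
  rw [measure_iUnion (fun i j hij => disjoint_Ico_of_disjoint_Ioo (h2 hij))
    (fun i => measurableSet_Ico), tsum_fintype,
    ENNReal.ofReal_sum_of_nonneg fun i _ => sub_nonneg.2 (g.mono (h1 i).le)]
  simp [measure_Ico]

/-- A function whose increments are dominated by the integral of a `g`-integrable function is
absolutely continuous with respect to `g`. -/
theorem absCont_of_norm_sub_le {k : ℝ → ℝ} {C : ℝ} (hk : IntegrableOn k (Ico a b) g.measure)
    (hf : ∀ l r, a ≤ l → l < r → r ≤ b →
      ‖f r - f l‖ ≤ C * ∫ u in Ico l r, k u ∂g.measure) :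
    g.AbsCont a b f := by
  intro ε hε
  set μ := g.measure.restrict (Ico a b)
  -- Absolute continuity of the integral, uniform over all sets of small measure, supplies δ.
  have T1 : Tendsto (fun s : Set ℝ => C * ∫ u in s, k u ∂μ) (comap μ (𝓝 0)) (𝓝 (C * 0)) :=
    (Integrable.tendsto_setIntegral_nhds_zero hk tendsto_comap).const_mul C
  rw [mul_zero] at T1
  have T2 := T1.eventually (gt_mem_nhds hε)
  rw [eventually_comap] at T2
  obtain ⟨δ, hδ, H⟩ := ENNReal.nhds_zero_basis.eventually_iff.1 T2
  obtain ⟨δ', -, hδ', hδδ⟩ := ENNReal.lt_iff_exists_real_btwn.1 hδ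
  rw [ENNReal.ofReal_pos] at hδ'
  refine ⟨δ', hδ', fun m l r h1 h2 h3 => ?_⟩
  have hsub : (⋃ i, Ico (l i) (r i)) ⊆ Ico a b :=
    iUnion_subset fun i => Ico_subset_Ico (h1 i).1 (h1 i).2.2
  have hms : MeasurableSet (⋃ i, Ico (l i) (r i)) := .iUnion fun i => measurableSet_Ico
  have hμ : μ (⋃ i, Ico (l i) (r i)) < δ := by
    rw [Measure.restrict_eq_self _ hsub, measure_iUnion_Ico (fun i => (h1 i).2.1) h2]
    exact (ENNReal.ofReal_le_ofReal h3.le).trans_lt hδδ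
  refine lt_of_le_of_lt ?_ (H hμ _ rfl)
  rw [Measure.restrict_restrict hms, inter_eq_left.2 hsub,
    integral_iUnion_fintype (fun i => measurableSet_Ico)
      (fun i j hij => disjoint_Ico_of_disjoint_Ioo (h2 hij))
      (fun i => hk.mono_set (Ico_subset_Ico (h1 i).1 (h1 i).2.2)), Finset.mul_sum]
  exact Finset.sum_le_sum fun i _ => hf _ _ (h1 i).1 (h1 i).2.1 (h1 i).2.2

theorem integral_Ico_sub (hf : IntegrableOn f (Ico a b) g.measure) {l r : ℝ}
    (hc : a ≤ l) (hlr : l ≤ r) (hr : r ≤ b) :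
    (∫ u in Ico a r, f u ∂g.measure) - ∫ u in Ico a l, f u ∂g.measure
      = ∫ u in Ico l r, f u ∂g.measure := by
  rw [← Ico_union_Ico_eq_Ico hc hlr, setIntegral_union Ico_disjoint_Ico_same measurableSet_Ico
    (hf.mono_set (Ico_subset_Ico le_rfl (hlr.trans hr))) (hf.mono_set (Ico_subset_Ico hc hr)),
    add_sub_cancel_left]

theorem absCont_integral (hf : IntegrableOn f (Ico a b) g.measure) :
    g.AbsCont a b (fun t => ∫ u in Ico a t, f u ∂g.measure) := by
  refine absCont_of_norm_sub_le (k := fun u => ‖f u‖) (C := 1) hf.norm fun l r hl hlr hr => ?_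
  rw [integral_Ico_sub hf hl hlr.le hr, one_mul]
  exact norm_integral_le_integral_norm _

end Derivator

/-! ### Transport to Lebesgue measure and the fundamental theorem of calculus -/

namespace Derivator

section Transport

theorem map_volume_eq_of_Ici {ν : Measure ℝ} {m : ℝ} {γ : ℝ → ℝ}
    (hγ : AEMeasurable γ (volume.restrict (Ico 0 m)))
    (h : ∀ t, volume (γ ⁻¹' Ici t ∩ Ico 0 m) = ν (Ici t)) :
    (volume.restrict (Ico 0 m)).map γ = ν := by
  have : IsFiniteMeasure ((volume.restrict (Ico 0 m)).map γ) :=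
    Measure.isFiniteMeasure_map _ _
  refine Measure.ext_of_Ici _ _ fun t => ?_
  rw [Measure.map_apply_of_aemeasurable hγ measurableSet_Ici, ← h, Measure.restrict_apply']
  exact measurableSet_Ico

/-- The largest point of `[0, T]` at which `g` is at most `x`. -/
noncomputable def quantile (g : Derivator) (T x : ℝ) : ℝ := sSup {s | s ∈ Icc 0 T ∧ g s ≤ x}

variable {g : Derivator} {T : ℝ}

theorem quantile_mem_Icc (hg0 : g 0 = 0) (hT : 0 < T) {x : ℝ} (hx : 0 ≤ x) :
    g.quantile T x ∈ Icc 0 T := by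
  have h0 : (0 : ℝ) ∈ {s | s ∈ Icc 0 T ∧ g s ≤ x} := ⟨⟨le_rfl, hT.le⟩, hg0.trans_le hx⟩
  exact ⟨le_csSup ⟨T, fun s hs => hs.1.2⟩ h0, csSup_le ⟨0, h0⟩ fun s hs => hs.1.2⟩

/-- Left-continuity of g makes the supremum defining the quantile attained. -/
theorem apply_quantile_le (hg0 : g 0 = 0) (hT : 0 < T) {x : ℝ} (hx : 0 ≤ x) :
    g (g.quantile T x) ≤ x := by
  have h0 : (0 : ℝ) ∈ {s | s ∈ Icc 0 T ∧ g s ≤ x} := ⟨⟨le_rfl, hT.le⟩, hg0.trans_le hx⟩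
  rcases (quantile_mem_Icc hg0 hT hx).1.eq_or_lt with h | h
  · rw [← h, hg0]; exact hx
  · have h1 : Tendsto g (𝓝[<] (g.quantile T x)) (𝓝 (g (g.quantile T x))) :=
      (g.leftCont _).mono Iio_subset_Iic_self
    refine le_of_tendsto h1 ?_
    filter_upwards [self_mem_nhdsWithin] with s hs
    obtain ⟨s', hs', hlt⟩ := exists_lt_of_lt_csSup ⟨0, h0⟩ hs
    exact (g.mono hlt.le).trans hs'.2

/-- The Galois connection by which preimages under the quantile are computed. -/
theorem le_quantile_iff (hg0 : g 0 = 0) (hT : 0 < T) {x t : ℝ} (hx : 0 ≤ x) (ht : t ∈ Icc 0 T) :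
    t ≤ g.quantile T x ↔ g t ≤ x := by
  refine ⟨fun h => (g.mono h).trans (apply_quantile_le hg0 hT hx), fun h => ?_⟩
  exact le_csSup ⟨T, fun s hs => hs.1.2⟩ ⟨ht, h⟩

theorem monotoneOn_quantile (hg0 : g 0 = 0) (hT : 0 < T) :
    MonotoneOn (g.quantile T) (Ico 0 (g T)) := by
  intro x hx y hy hxy
  rw [le_quantile_iff hg0 hT hy.1 (quantile_mem_Icc hg0 hT hx.1)]
  exact (apply_quantile_le hg0 hT hx.1).trans hxy

theorem aemeasurable_quantile (hg0 : g 0 = 0) (hT : 0 < T) :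
    AEMeasurable (g.quantile T) (volume.restrict (Ico 0 (g T))) :=
  aemeasurable_restrict_of_monotoneOn measurableSet_Ico (monotoneOn_quantile hg0 hT)

theorem map_quantile (hg0 : g 0 = 0) (hT : 0 < T) :
    (volume.restrict (Ico 0 (g T))).map (g.quantile T) = g.measure.restrict (Ico 0 T) := by
  refine map_volume_eq_of_Ici (aemeasurable_quantile hg0 hT) fun t => ?_
  rw [Measure.restrict_apply measurableSet_Ici]
  rcases le_total t 0 with h0 | h0
  · have e1 : g.quantile T ⁻¹' Ici t ∩ Ico 0 (g T) = Ico 0 (g T) :=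
      inter_eq_right.2 fun x hx => h0.trans (quantile_mem_Icc hg0 hT hx.1).1
    have e2 : Ici t ∩ Ico 0 T = Ico 0 T := inter_eq_right.2 fun x hx => h0.trans hx.1
    rw [e1, e2, measure_Ico, Real.volume_Ico, hg0]
  rcases le_or_gt t T with h1 | h1
  · have e1 : g.quantile T ⁻¹' Ici t ∩ Ico 0 (g T) = Ico (g t) (g T) := by
      ext x
      have hgt : 0 ≤ g t := hg0.symm.trans_le (g.mono h0)
      constructor
      · rintro ⟨a1, a2⟩
        exact ⟨(le_quantile_iff hg0 hT a2.1 ⟨h0, h1⟩).1 a1, a2.2⟩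
      · rintro ⟨a1, a2⟩
        exact ⟨(le_quantile_iff hg0 hT (hgt.trans a1) ⟨h0, h1⟩).2 a1, hgt.trans a1, a2⟩
    have e2 : Ici t ∩ Ico 0 T = Ico t T := by
      ext x
      exact ⟨fun h => ⟨h.1, h.2.2⟩, fun h => ⟨h.1, h0.trans h.1, h.2⟩⟩
    rw [e1, e2, measure_Ico, Real.volume_Ico]
  · have e1 : g.quantile T ⁻¹' Ici t ∩ Ico 0 (g T) = ∅ := by
      refine eq_empty_of_forall_notMem fun x hx => ?_
      exact absurd (hx.1.trans (quantile_mem_Icc hg0 hT hx.2.1).2) (not_le.2 h1)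
    have e2 : Ici t ∩ Ico 0 T = ∅ := by
      refine eq_empty_of_forall_notMem fun x hx => ?_
      exact absurd (hx.1.trans hx.2.2.le) (not_le.2 h1)
    rw [e1, e2, measure_empty, measure_empty]

/-- Immediately to the right of the quantile g exceeds x, so continuity there gives the missing
inequality. -/
theorem apply_quantile_eq (hg0 : g 0 = 0) (hT : 0 < T) {x : ℝ} (hx : x ∈ Ico 0 (g T))
    (hD : g.quantile T x ∉ g.D) : g (g.quantile T x) = x := by
  refine le_antisymm (apply_quantile_le hg0 hT hx.1) ?_
  have hq := quantile_mem_Icc hg0 hT hx.1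
  have hqT : g.quantile T x < T := by
    refine hq.2.lt_of_ne fun h => ?_
    have := apply_quantile_le hg0 hT hx.1
    rw [h] at this
    exact absurd hx.2 (not_lt.2 this)
  have h1 : Tendsto g (𝓝[>] (g.quantile T x)) (𝓝 (g (g.quantile T x))) :=
    (continuousAt_of_notMem_D hD).mono_left nhdsWithin_le_nhds
  refine ge_of_tendsto h1 ?_
  filter_upwards [Ioo_mem_nhdsGT hqT] with s hs
  by_contra! hlt
  exact absurd ((le_quantile_iff hg0 hT hx.1 ⟨hq.1.trans hs.1.le, hs.2.le⟩).2 hlt.le)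
    (not_le.2 hs.1)

/-- Lebesgue-null sets of values of `g` pull back to `μ_g`-null sets of continuity points. -/
theorem ae_notMem_of_volume_eq_zero (hg0 : g 0 = 0) (hT : 0 < T) {B : Set ℝ}
    (hB : volume B = 0) : ∀ᵐ t ∂g.measure.restrict (Ico 0 T), t ∉ g.D → g t ∉ B := by
  obtain ⟨B', hBB, hmB, hB'⟩ := exists_measurable_superset_of_null hB
  suffices h : ∀ᵐ t ∂g.measure.restrict (Ico 0 T), t ∉ g.D → g t ∉ B' by
    filter_upwards [h] with t ht hD hB using ht hD (hBB hB)
  have hms : MeasurableSet {t | t ∉ g.D → g t ∉ B'} := by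
    have : {t | t ∉ g.D → g t ∉ B'} = g.D ∪ (g ⁻¹' B')ᶜ := by
      ext t; simp only [mem_ofPred_eq, mem_union, mem_compl_iff, mem_preimage]; tauto
    rw [this]
    exact g.measurableSet_D.union (g.mono.measurable hmB).compl
  rw [← map_quantile hg0 hT, ae_map_iff (aemeasurable_quantile hg0 hT) hms]
  have h0 : ∀ᵐ x ∂(volume.restrict (Ico 0 (g T))), x ∉ B' :=
    ae_restrict_of_ae (measure_eq_zero_iff_ae_notMem.1 hB')
  filter_upwards [h0, ae_restrict_mem measurableSet_Ico] with x hx hx2 hD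
  rwa [apply_quantile_eq hg0 hT hx2 hD]

end Transport

variable {𝕜 : Type*} [RCLike 𝕜] {g : Derivator} {T : ℝ} {f : ℝ → 𝕜}

theorem integral_Ico_eq_integral_quantile (hg0 : g 0 = 0) (hT : 0 < T)
    (hf : IntegrableOn f (Ico 0 T) g.measure) {t : ℝ} (ht : t ∈ Icc 0 T) :
    ∫ u in Ico 0 t, f u ∂g.measure = ∫ x in (0 : ℝ)..g t, f (g.quantile T x) := by
  have hgt : 0 ≤ g t := hg0.symm.trans_le (g.mono ht.1)
  have hae := aemeasurable_quantile hg0 hT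
  have hf' := hf.aestronglyMeasurable
  rw [← map_quantile hg0 hT] at hf'
  have e1 : g.measure.restrict (Ico 0 t) = (g.measure.restrict (Ico 0 T)).restrict (Ico 0 t) := by
    rw [Measure.restrict_restrict measurableSet_Ico, inter_eq_left.2 (Ico_subset_Ico_right ht.2)]
  rw [e1, ← map_quantile hg0 hT, Measure.restrict_map_of_aemeasurable hae measurableSet_Ico,
    intervalIntegral.integral_of_le hgt, ← integral_Ico_eq_integral_Ioc]
  have e2 : (volume.restrict (Ico 0 (g T))).restrict (g.quantile T ⁻¹' Ico 0 t)
      = volume.restrict (Ico 0 (g t)) := by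
    rw [Measure.restrict_restrict']
    · congr 1
      ext x
      constructor
      · rintro ⟨h1, h2⟩
        refine ⟨h2.1, ?_⟩
        by_contra! h3
        exact absurd h1.2 (not_lt.2 ((le_quantile_iff hg0 hT h2.1 ht).2 h3))
      · rintro ⟨h1, h2⟩
        refine ⟨⟨(quantile_mem_Icc hg0 hT h1).1, ?_⟩, h1, h2.trans_le (g.mono ht.2)⟩
        by_contra! h3
        exact absurd h2 (not_lt.2 ((le_quantile_iff hg0 hT h1 ht).1 h3))
    · exact measurableSet_Ico
  rw [e2, integral_map]
  · exact hae.mono_measure (Measure.restrict_mono_set _ (Ico_subset_Ico_right (g.mono ht.2)))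
  · rw [← e2, ← Measure.restrict_map_of_aemeasurable hae measurableSet_Ico]
    exact hf'.mono_measure Measure.restrict_le_self

/-- With the atom at t left out, the mass of (t, s) is g(s) - g(t⁺), which tends to 0. -/
theorem tendsto_integral_Ioo {E : Type*} [NormedAddCommGroup E] [NormedSpace ℝ E] {f : ℝ → E}
    (hf : IntegrableOn f (Ico 0 T) g.measure) {t : ℝ} (ht : t ∈ Ico 0 T) :
    Tendsto (fun s => ∫ u in Ioo t s, f u ∂g.measure) (𝓝[>] t) (𝓝 0) := by
  have h1 : Tendsto (fun s => ∫ u in Ioo t s, f u ∂(g.measure.restrict (Ico 0 T)))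
      (𝓝[>] t) (𝓝 0) := by
    refine Integrable.tendsto_setIntegral_nhds_zero hf ?_
    have h2 : Tendsto (fun s => ENNReal.ofReal (g s - (g t + g.jump t))) (𝓝[>] t) (𝓝 0) := by
      rw [← ENNReal.ofReal_zero]
      refine ENNReal.tendsto_ofReal ?_
      simpa using (g.tendsto_nhdsGT t).sub_const (g t + g.jump t)
    refine tendsto_of_tendsto_of_tendsto_of_le_of_le' tendsto_const_nhds h2
      (.of_forall fun _ => zero_le) ?_
    filter_upwards [self_mem_nhdsWithin] with s hs
    have hts : t < s := hs
    refine (Measure.restrict_apply_le _ _).trans ?_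
    have h3 : Ioo t s = Ico t s \ {t} := by rw [Ico_sdiff_left]
    rw [h3, measure_sdiff (by simpa using hts) (measurableSet_singleton t).nullMeasurableSet
      (by rw [measure_singleton]; exact ENNReal.ofReal_ne_top), measure_Ico, measure_singleton,
      ← ENNReal.ofReal_sub _ (g.jump_nonneg t), sub_sub]
  refine h1.congr' ?_
  filter_upwards [Ioo_mem_nhdsGT ht.2] with s hs
  rw [Measure.restrict_restrict measurableSet_Ioo, inter_eq_left.2]
  exact fun u hu => ⟨ht.1.trans hu.1.le, hu.2.trans hs.2⟩

theorem integral_Ico_eq_add_integral_Ioo (hf : IntegrableOn f (Ico 0 T) g.measure) {t s : ℝ}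
    (ht : 0 ≤ t) (hts : t < s) (hs : s ≤ T) :
    ∫ u in Ico t s, f u ∂g.measure = f t * (g.jump t : 𝕜) + ∫ u in Ioo t s, f u ∂g.measure := by
  have h1 : Ico t s = {t} ∪ Ioo t s := by
    rw [singleton_union, Ioo_insert_left hts]
  have hsub : Ico t s ⊆ Ico 0 T := Ico_subset_Ico ht hs
  have h2 : Disjoint {t} (Ioo t s) := by simp
  rw [h1] at hsub ⊢
  rw [setIntegral_union h2 measurableSet_Ioo
    (hf.mono_set (subset_union_left.trans hsub)) (hf.mono_set (subset_union_right.trans hsub)),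
    integral_singleton, measureReal_singleton, RCLike.real_smul_eq_coe_mul, mul_comm]

theorem derivFilter_of_mem_D {t : ℝ} (h : t ∈ g.D) : g.derivFilter T t = 𝓝[Ioc t T] t := by
  rw [derivFilter, if_pos h]

theorem derivFilter_of_notMem_D {t : ℝ} (h : t ∉ g.D) :
    g.derivFilter T t = 𝓝[{s | s ∈ Icc 0 T ∧ g s ≠ g t}] t := by
  rw [derivFilter, if_neg h]

theorem ae_neBot_derivFilter (hg0 : g 0 = 0) (hT : 0 < T) :
    ∀ᵐ t ∂g.measure.restrict (Ico 0 T), (g.derivFilter T t).NeBot := by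
  -- A monotone function takes only countably many values more than once; these levels pull back to
  -- a μ_g-null set of continuity points.
  have hC : volume {c | ∃ x y, x < y ∧ g x = c ∧ g y = c} = 0 :=
    (g.mono.countable_setOfPred_two_preimages).measure_zero _
  filter_upwards [ae_notMem_of_volume_eq_zero hg0 hT hC, ae_restrict_mem measurableSet_Ico]
    with t ht hts
  by_cases hD : t ∈ g.D
  · rw [derivFilter_of_mem_D hD, nhdsWithin_Ioc_eq_nhdsGT hts.2]
    infer_instance
  · rw [derivFilter_of_notMem_D hD]
    have : (𝓝[>] t).NeBot := inferInstance
    rw [← nhdsWithin_Ioc_eq_nhdsGT hts.2] at this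
    refine this.mono (nhdsWithin_mono _ fun s hs => ⟨⟨hts.1.trans hs.1.le, hs.2⟩, fun h => ?_⟩)
    exact ht hD ⟨t, s, hs.1, rfl, h⟩

/-- **Fundamental theorem of calculus** for the Lebesgue–Stieltjes integral. -/
theorem ae_hasDerivAt_integral (hg0 : g 0 = 0) (hT : 0 < T)
    (hf : IntegrableOn f (Ico 0 T) g.measure) :
    ∀ᵐ t ∂g.measure.restrict (Ico 0 T),
      g.HasDerivAt T (fun t => ∫ u in Ico 0 t, f u ∂g.measure) (f t) t := by
  have hgT : 0 ≤ g T := hg0.symm.trans_le (g.mono hT.le)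
  have hint : IntervalIntegrable (fun x => f (g.quantile T x)) volume 0 (g T) := by
    rw [intervalIntegrable_iff_integrableOn_Ico_of_le hgT]
    have hf' := hf
    rw [IntegrableOn, ← map_quantile hg0 hT, integrable_map_measure _
      (aemeasurable_quantile hg0 hT)] at hf'
    · exact hf'
    · rw [map_quantile hg0 hT]; exact hf.aestronglyMeasurable
  have hC : volume {c | ∃ x y, x < y ∧ g x = c ∧ g y = c} = 0 :=
    (g.mono.countable_setOfPred_two_preimages).measure_zero _
  have hB := hint.ae_hasDerivAt_integral
  rw [ae_iff] at hB
  filter_upwards [ae_notMem_of_volume_eq_zero hg0 hT hC, ae_notMem_of_volume_eq_zero hg0 hT hB,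
    ae_neBot_derivFilter hg0 hT, ae_restrict_mem measurableSet_Ico] with t htC htB hne hts
  refine ⟨hne, ?_⟩
  have htI : t ∈ Icc 0 T := ⟨hts.1, hts.2.le⟩
  by_cases hD : t ∈ g.D
  · rw [derivFilter_of_mem_D hD, nhdsWithin_Ioc_eq_nhdsGT hts.2]
    have hj : (g.jump t : 𝕜) ≠ 0 := by
      have : 0 < g.jump t := hD
      exact_mod_cast this.ne'
    -- At a jump only the atom survives in the limit, in the numerator and in the denominator alike.
    have h1 : Tendsto (fun s => f t * (g.jump t : 𝕜) + ∫ u in Ioo t s, f u ∂g.measure) (𝓝[>] t)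
        (𝓝 (f t * (g.jump t : 𝕜))) := by
      simpa using (tendsto_integral_Ioo hf hts).const_add (f t * (g.jump t : 𝕜))
    have h2 : Tendsto (fun s => ((g s - g t : ℝ) : 𝕜)) (𝓝[>] t) (𝓝 (g.jump t : 𝕜)) := by
      refine (RCLike.continuous_ofReal.tendsto _).comp ?_
      simpa using (g.tendsto_nhdsGT t).sub_const (g t)
    have h3 := h1.div h2 hj
    rw [mul_div_cancel_right₀ _ hj] at h3
    refine h3.congr' ?_
    filter_upwards [Ioo_mem_nhdsGT hts.2] with s hs
    rw [Pi.div_apply, integral_Ico_sub hf hts.1 hs.1.le hs.2.le,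
      integral_Ico_eq_add_integral_Ioo hf hts.1 hs.1 hs.2.le]
  · rw [derivFilter_of_notMem_D hD]
    have hgt : g t ∈ Icc 0 (g T) := ⟨hg0.symm.trans_le (g.mono hts.1), g.mono hts.2.le⟩
    have hder := (not_not.1 (htB hD)) (by rwa [uIcc_of_le hgT]) 0
      (by rw [uIcc_of_le hgT]; exact ⟨le_rfl, hgT⟩)
    -- The level g(t) is attained only at t, so the quantile inverts g there.
    have hq : g.quantile T (g t) = t := by
      have h1 : t ≤ g.quantile T (g t) := (le_quantile_iff hg0 hT hgt.1 htI).2 le_rfl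
      refine (h1.eq_or_lt.resolve_right fun h2 => htC hD ⟨_, _, h2, rfl, ?_⟩).symm
      exact le_antisymm (apply_quantile_le hg0 hT hgt.1) (g.mono h1)
    rw [hq, hasDerivAt_iff_tendsto_slope] at hder
    have h1 : Tendsto g (𝓝[{s | s ∈ Icc 0 T ∧ g s ≠ g t}] t) (𝓝[≠] (g t)) := by
      refine tendsto_nhdsWithin_iff.2
        ⟨(continuousAt_of_notMem_D hD).mono_left nhdsWithin_le_nhds, ?_⟩
      filter_upwards [self_mem_nhdsWithin] with s hs using hs.2
    refine (hder.comp h1).congr' ?_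
    filter_upwards [self_mem_nhdsWithin] with s hs
    rw [Function.comp_apply, slope_def_module, ← integral_Ico_eq_integral_quantile hg0 hT hf hs.1,
      ← integral_Ico_eq_integral_quantile hg0 hT hf htI, RCLike.real_smul_eq_coe_mul,
      RCLike.ofReal_inv, div_eq_inv_mul]

end Derivator

/-! ### Mean value inequality and uniqueness -/

namespace Derivator

/-- Continuous induction: left-continuity of w carries the bound to the supremum of the good points,
and the local hypothesis carries it beyond. H need only be monotone, so it may jump. -/
theorem norm_sub_le_of_eventually_nhdsGT {E : Type*} [NormedAddCommGroup E] {w : ℝ → E}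
    {H : ℝ → ℝ} {a b : ℝ} (hab : a ≤ b) (hH : MonotoneOn H (Icc a b))
    (hw : ∀ t ∈ Ioc a b, Tendsto w (𝓝[<] t) (𝓝 (w t)))
    (h : ∀ t ∈ Ico a b, ∀ᶠ s in 𝓝[>] t, ‖w s - w t‖ ≤ H s - H t) :
    ‖w b - w a‖ ≤ H b - H a := by
  set S : Set ℝ := {t | t ∈ Icc a b ∧ ∀ s ∈ Icc a t, ‖w s - w a‖ ≤ H s - H a}
  have haS : a ∈ S := by
    refine ⟨⟨le_rfl, hab⟩, fun s hs => ?_⟩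
    have : s = a := le_antisymm hs.2 hs.1
    simp [this]
  have hbdd : BddAbove S := ⟨b, fun t ht => ht.1.2⟩
  set c := sSup S
  have hac : a ≤ c := le_csSup hbdd haS
  have hcb : c ≤ b := csSup_le ⟨a, haS⟩ fun t ht => ht.1.2
  have hlt : ∀ s, a ≤ s → s < c → ‖w s - w a‖ ≤ H s - H a := by
    intro s has hsc
    obtain ⟨t, ht, hst⟩ := exists_lt_of_lt_csSup ⟨a, haS⟩ hsc
    exact ht.2 s ⟨has, hst.le⟩
  have hc : ‖w c - w a‖ ≤ H c - H a := by
    rcases hac.eq_or_lt with h0 | h0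
    · simp [← h0]
    refine le_of_tendsto ((hw c ⟨h0, hcb⟩).sub_const (w a)).norm ?_
    filter_upwards [Ioo_mem_nhdsLT h0] with s hs
    have := hH ⟨hs.1.le, hs.2.le.trans hcb⟩ ⟨hac, hcb⟩ hs.2.le
    linarith [hlt s hs.1.le hs.2]
  rcases hcb.eq_or_lt with h1 | h1
  · rwa [h1] at hc
  exfalso
  obtain ⟨d, hd, hsub⟩ := (mem_nhdsGT_iff_exists_Ioo_subset' h1).1 (h c ⟨hac, h1⟩)
  obtain ⟨e, he1, he2⟩ := exists_between (lt_min hd h1)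
  have heS : e ∈ S := by
    refine ⟨⟨hac.trans he1.le, he2.le.trans (min_le_right _ _)⟩, fun s hs => ?_⟩
    rcases lt_trichotomy s c with h2 | rfl | h2
    · exact hlt s hs.1 h2
    · exact hc
    · have h3 : ‖w s - w c‖ ≤ H s - H c :=
        hsub ⟨h2, hs.2.trans_lt (he2.trans_le (min_le_left _ _))⟩
      have := norm_sub_le_norm_sub_add_norm_sub (w s) (w c) (w a)
      linarith
  exact absurd (le_csSup hbdd heS) (not_le.2 he1)

variable {𝕜 : Type*} [RCLike 𝕜] {g : Derivator} {a b T : ℝ} {w β : ℝ → 𝕜}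

theorem AbsCont.mono {a' b' : ℝ} (hw : g.AbsCont a b w) (ha : a ≤ a') (hb : b' ≤ b) :
    g.AbsCont a' b' w := by
  intro ε hε
  obtain ⟨δ, hδ, H⟩ := hw ε hε
  exact ⟨δ, hδ, fun m l r h1 h2 h3 => H m l r
    (fun i => ⟨ha.trans (h1 i).1, (h1 i).2.1, (h1 i).2.2.trans hb⟩) h2 h3⟩

/-- The variation of an absolutely continuous function inside a set of small measure is dominated
by the increments of a monotone function of small total increase. -/
theorem AbsCont.exists_monotoneOn_norm_sub_le (hw : g.AbsCont a b w) (hab : a ≤ b) {ε : ℝ}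
    (hε : 0 < ε) :
    ∃ δ : ℝ, 0 < δ ∧ ∀ U : Set ℝ, g.measure U < ENNReal.ofReal δ →
      ∃ V : ℝ → ℝ, MonotoneOn V (Icc a b) ∧ 0 ≤ V a ∧ V b ≤ ε ∧
        ∀ t s, a ≤ t → t < s → s ≤ b → Ico t s ⊆ U → ‖w s - w t‖ ≤ V s - V t := by
  obtain ⟨δ, hδ, H⟩ := hw ε hε
  refine ⟨δ, hδ, fun U hU => ?_⟩
  -- The variation sums of w over intervals ending by t and lying in U; V(t) is their supremum.
  let F : ℝ → Set ℝ := fun t => {x | ∃ (m : ℕ) (l r : Fin m → ℝ),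
    (∀ i, a ≤ l i ∧ l i < r i ∧ r i ≤ t ∧ Ico (l i) (r i) ⊆ U) ∧
    (Pairwise fun i j => Disjoint (Ioo (l i) (r i)) (Ioo (l j) (r j))) ∧
    x = ∑ i, ‖w (r i) - w (l i)‖}
  have hF0 : ∀ t, (0 : ℝ) ∈ F t := fun t =>
    ⟨0, Fin.elim0, Fin.elim0, fun i => i.elim0, fun i => i.elim0, by simp⟩
  have hFle : ∀ t ≤ b, ∀ x ∈ F t, x ≤ ε := by
    rintro t ht x ⟨m, l, r, h1, h2, rfl⟩
    refine (H m l r (fun i => ⟨(h1 i).1, (h1 i).2.1, (h1 i).2.2.1.trans ht⟩) h2 ?_).le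
    have h3 : g.measure (⋃ i, Ico (l i) (r i)) < ENNReal.ofReal δ :=
      (measure_mono (iUnion_subset fun i => (h1 i).2.2.2)).trans_lt hU
    rw [measure_iUnion_Ico (fun i => (h1 i).2.1) h2] at h3
    exact (ENNReal.ofReal_lt_ofReal_iff hδ).1 h3
  have hbdd : ∀ t ≤ b, BddAbove (F t) := fun t ht => ⟨ε, hFle t ht⟩
  refine ⟨fun t => sSup (F t), ?_, le_csSup (hbdd a hab) (hF0 a),
    csSup_le ⟨0, hF0 b⟩ (hFle b le_rfl), ?_⟩
  · intro s hs t ht hst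
    refine csSup_le_csSup (hbdd t ht.2) ⟨0, hF0 s⟩ ?_
    rintro x ⟨m, l, r, h1, h2, rfl⟩
    exact ⟨m, l, r, fun i => ⟨(h1 i).1, (h1 i).2.1, (h1 i).2.2.1.trans hst, (h1 i).2.2.2⟩, h2, rfl⟩
  · intro t s hat hts hsb hU'
    rw [le_sub_comm]
    refine csSup_le ⟨0, hF0 t⟩ ?_
    rintro x ⟨m, l, r, h1, h2, rfl⟩
    rw [le_sub_iff_add_le']
    refine le_csSup (hbdd s hsb) ⟨m + 1, Fin.cons t l, Fin.cons s r, ?_, ?_, ?_⟩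
    · intro i
      refine Fin.cases ?_ (fun i => ?_) i
      · exact ⟨hat, hts, le_rfl, hU'⟩
      · exact ⟨(h1 i).1, (h1 i).2.1, (h1 i).2.2.1.trans hts.le, (h1 i).2.2.2⟩
    · have hdis : ∀ i, Disjoint (Ioo (l i) (r i)) (Ioo t s) := fun i =>
        Set.disjoint_left.2 fun x hx hx' => absurd (hx.2.trans_le (h1 i).2.2.1) (not_lt.2 hx'.1.le)
      intro i j
      refine Fin.cases ?_ (fun i => ?_) i <;> refine Fin.cases ?_ (fun j => ?_) j <;> intro hij
      · exact absurd rfl hij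
      · exact (hdis j).symm
      · exact hdis i
      · exact h2 fun h => hij (congrArg Fin.succ h)
    · rw [Fin.sum_univ_succ]; simp

/-- **Mean value inequality**: the increment of an absolutely continuous function is bounded by the
integral of an almost everywhere bound of its right `g`-difference quotients. -/
theorem AbsCont.norm_sub_le_integral (hw : g.AbsCont 0 T w)
    {k : ℝ → ℝ} (hk : IntegrableOn k (Ico 0 T) g.measure) (hk0 : ∀ t, 0 ≤ k t) (ha : 0 ≤ a)
    (hab : a ≤ b) (hb : b ≤ T)
    (hd : ∀ᵐ t ∂g.measure.restrict (Ico 0 T), t ∈ Ico a b → ∀ ε : ℝ, 0 < ε →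
      ∀ᶠ s in 𝓝[>] t, ‖w s - w t‖ ≤ (k t + ε) * (g s - g t))
    (hK : ∀ᵐ t ∂g.measure.restrict (Ico 0 T), ∀ ε : ℝ, 0 < ε →
      ∀ᶠ s in 𝓝[>] t, (k t - ε) * (g s - g t) ≤
        (∫ u in Ico 0 s, k u ∂g.measure) - ∫ u in Ico 0 t, k u ∂g.measure) :
    ‖w b - w a‖ ≤ ∫ u in Ico a b, k u ∂g.measure := by
  have hgab : g a ≤ g b := g.mono hab
  refine le_of_forall_pos_le_add fun η hη => ?_
  -- Two errors ε(g b - g a) come from the difference quotients of w and of the integral, and one ε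
  -- from the variation over the exceptional set.
  set ε := η / (2 * (g b - g a) + 1)
  have hden : 0 < 2 * (g b - g a) + 1 := by linarith
  have hε : 0 < ε := div_pos hη hden
  have hεη : ε * (2 * (g b - g a) + 1) = η := div_mul_cancel₀ _ hden.ne'
  obtain ⟨δ, hδ, HU⟩ := (hw.mono ha hb).exists_monotoneOn_norm_sub_le hab hε
  set N : Set ℝ := {t | t ∈ Ico a b ∧ ¬ ((∀ᶠ s in 𝓝[>] t, ‖w s - w t‖ ≤ (k t + ε) * (g s - g t)) ∧
    ∀ᶠ s in 𝓝[>] t, (k t - ε) * (g s - g t) ≤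
      (∫ u in Ico 0 s, k u ∂g.measure) - ∫ u in Ico 0 t, k u ∂g.measure)}
  have hN : g.measure N = 0 := by
    have h1 : ∀ᵐ t ∂g.measure.restrict (Ico 0 T), t ∉ N := by
      filter_upwards [hd, hK] with t h1 h2 h3
      exact h3.2 ⟨h1 h3.1 ε hε, h2 ε hε⟩
    rw [ae_restrict_iff' measurableSet_Ico] at h1
    refine measure_eq_zero_iff_ae_notMem.2 ?_
    filter_upwards [h1] with t ht htN
    exact ht (Ico_subset_Ico ha hb htN.1) htN
  obtain ⟨U, hNU, hUo, hμU⟩ := N.exists_isOpen_lt_of_lt (μ := g.measure) (ENNReal.ofReal δ)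
    (by rw [hN]; exact ENNReal.ofReal_pos.2 hδ)
  obtain ⟨V, hVm, hVa, hVb, hV⟩ := HU U hμU
  set K : ℝ → ℝ := fun t => ∫ u in Ico 0 t, k u ∂g.measure
  have hKsub : ∀ l r, a ≤ l → l ≤ r → r ≤ b → K r - K l = ∫ u in Ico l r, k u ∂g.measure :=
    fun l r h1 h2 h3 => integral_Ico_sub hk (ha.trans h1) h2 (h3.trans hb)
  have hKm : ∀ l r, a ≤ l → l ≤ r → r ≤ b → K l ≤ K r := fun l r h1 h2 h3 => by
    rw [← sub_nonneg, hKsub l r h1 h2 h3]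
    exact setIntegral_nonneg measurableSet_Ico fun u _ => hk0 u
  -- At points of the null set N the term V controls w, because [t, s) lies in the open set U for s
  -- near t; at other points K + 2εg does.
  have key := norm_sub_le_of_eventually_nhdsGT (w := w) (H := fun t => K t + 2 * ε * g t + V t) hab
    (fun s hs t ht hst => add_le_add (add_le_add (hKm s t hs.1 hst ht.2)
      (mul_le_mul_of_nonneg_left (g.mono hst) (by positivity))) (hVm hs ht hst))
    (fun t ht => hw.tendsto_left (ha.trans_lt ht.1) (ht.2.trans hb))
    (fun t ht => by
      by_cases htN : t ∈ N
      · have h1 : ∀ᶠ s in 𝓝[>] t, Ico t s ⊆ U := by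
          obtain ⟨d, hd, hsub⟩ := (mem_nhdsGE_iff_exists_Ico_subset).1
            (mem_nhdsWithin_of_mem_nhds (hUo.mem_nhds (hNU htN)) : U ∈ 𝓝[≥] t)
          filter_upwards [Ioo_mem_nhdsGT hd] with s hs
          exact (Ico_subset_Ico_right hs.2.le).trans hsub
        filter_upwards [h1, Ioo_mem_nhdsGT ht.2] with s hs1 hs2
        have h2 := hV t s ht.1 hs2.1 hs2.2.le hs1
        have h3 := hKm t s ht.1 hs2.1.le hs2.2.le
        have h4 : 2 * ε * g t ≤ 2 * ε * g s :=
          mul_le_mul_of_nonneg_left (g.mono hs2.1.le) (by positivity)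
        linarith
      · have h0 : (∀ᶠ s in 𝓝[>] t, ‖w s - w t‖ ≤ (k t + ε) * (g s - g t)) ∧
          ∀ᶠ s in 𝓝[>] t, (k t - ε) * (g s - g t) ≤ K s - K t := by
          by_contra hcon
          exact htN ⟨ht, hcon⟩
        filter_upwards [h0.1, h0.2, Ioo_mem_nhdsGT ht.2] with s h1 h2 hs
        have h3 := hVm ⟨ht.1, ht.2.le⟩ ⟨ht.1.trans hs.1.le, hs.2.le⟩ hs.1.le
        linarith)
  have h1 := hKsub a b le_rfl hab le_rfl
  have h2 : K b + 2 * ε * g b + V b - (K a + 2 * ε * g a + V a) ≤ K b - K a + η := by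
    rw [← hεη]; linarith
  rw [← h1]
  exact key.trans h2

/-- The derivative says nothing about points s with g(s) = g(t), but there absolute continuity
forces w(s) = w(t). -/
theorem AbsCont.eventually_norm_sub_sub_le (hw : g.AbsCont 0 T w) {L : 𝕜} {t : ℝ}
    (ht : t ∈ Ico 0 T) (hd : g.HasDerivAt T w L t) {ε : ℝ} (hε : 0 < ε) :
    ∀ᶠ s in 𝓝[>] t, ‖w s - w t - L * ((g s - g t : ℝ) : 𝕜)‖ ≤ ε * (g s - g t) := by
  have key : ∀ s, t < s → g s ≠ g t →
      ‖(w s - w t) / ((g s - g t : ℝ) : 𝕜) - L‖ < ε →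
      ‖w s - w t - L * ((g s - g t : ℝ) : 𝕜)‖ ≤ ε * (g s - g t) := by
    intro s hs hne h
    have h0 : 0 < g s - g t := sub_pos.2 ((g.mono hs.le).lt_of_ne (Ne.symm hne))
    have h1 : ((g s - g t : ℝ) : 𝕜) ≠ 0 := by exact_mod_cast h0.ne'
    have h2 : w s - w t - L * ((g s - g t : ℝ) : 𝕜)
        = ((w s - w t) / ((g s - g t : ℝ) : 𝕜) - L) * ((g s - g t : ℝ) : 𝕜) := by
      rw [sub_mul, div_mul_cancel₀ _ h1]
    rw [h2, norm_mul, RCLike.norm_ofReal, abs_of_pos h0]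
    exact mul_le_mul_of_nonneg_right h.le h0.le
  have hlim := (tendsto_iff_norm_sub_tendsto_zero.1 hd.2).eventually (gt_mem_nhds hε)
  by_cases hD : t ∈ g.D
  · rw [derivFilter_of_mem_D hD, nhdsWithin_Ioc_eq_nhdsGT ht.2] at hlim
    have h1 := (g.tendsto_nhdsGT t).eventually
      (lt_mem_nhds (show g t < g t + g.jump t from lt_add_of_pos_right _ hD))
    filter_upwards [hlim, h1, self_mem_nhdsWithin] with s hs h2 h3
    exact key s h3 h2.ne' hs
  · rw [derivFilter_of_notMem_D hD, eventually_nhdsWithin_iff] at hlim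
    filter_upwards [mem_nhdsWithin_of_mem_nhds hlim, Ioo_mem_nhdsGT ht.2] with s hs hst
    by_cases hne : g s = g t
    · have := hw.eq_of_eq ht.1 hst.1.le hst.2.le hne.symm
      simp [hne, this]
    · exact key s hst.1 hne (hs ⟨⟨ht.1.trans hst.1.le, hst.2.le⟩, hne⟩)

theorem ae_eventually_le_integral_sub (hg0 : g 0 = 0) (hT : 0 < T) {k : ℝ → ℝ}
    (hk : IntegrableOn k (Ico 0 T) g.measure) :
    ∀ᵐ t ∂g.measure.restrict (Ico 0 T), ∀ ε : ℝ, 0 < ε →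
      ∀ᶠ s in 𝓝[>] t, (k t - ε) * (g s - g t) ≤
        (∫ u in Ico 0 s, k u ∂g.measure) - ∫ u in Ico 0 t, k u ∂g.measure := by
  filter_upwards [ae_hasDerivAt_integral hg0 hT hk, ae_restrict_mem measurableSet_Ico]
    with t ht hts ε hε
  filter_upwards [(absCont_integral hk).eventually_norm_sub_sub_le hts ht hε] with s hs
  rw [Real.norm_eq_abs] at hs
  have := (abs_le.1 hs).1
  simp only [RCLike.ofReal_real_eq_id, id_eq] at this
  linarith

/-- Let τ end the longest initial interval on which w vanishes. If τ < T, choose s > τ with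
∫_{(τ,s)} |β| dμ_g < 1/2; the mean value inequality then gives M ≤ M/2 for M = sup |w| over (τ, s].
-/
theorem AbsCont.eq_zero_of_hasDerivAt (hg0 : g 0 = 0) (hT : 0 < T)
    (hβ : IntegrableOn β (Ico 0 T) g.measure) (hw : g.AbsCont 0 T w) (hw0 : w 0 = 0)
    (hd : ∀ᵐ t ∂g.measure.restrict (Ico 0 T), g.HasDerivAt T w (β t * w t) t) :
    ∀ t ∈ Icc 0 T, w t = 0 := by
  set S : Set ℝ := {t | t ∈ Icc 0 T ∧ ∀ s ∈ Icc 0 t, w s = 0}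
  have h0S : (0 : ℝ) ∈ S := ⟨⟨le_rfl, hT.le⟩, fun s hs => by rw [le_antisymm hs.2 hs.1, hw0]⟩
  have hbdd : BddAbove S := ⟨T, fun t ht => ht.1.2⟩
  set τ := sSup S
  have h0τ : 0 ≤ τ := le_csSup hbdd h0S
  have hτT : τ ≤ T := csSup_le ⟨0, h0S⟩ fun t ht => ht.1.2
  have hlt : ∀ s, 0 ≤ s → s < τ → w s = 0 := by
    intro s has hsc
    obtain ⟨t, ht, hst⟩ := exists_lt_of_lt_csSup ⟨0, h0S⟩ hsc
    exact ht.2 s ⟨has, hst.le⟩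
  have hτ : w τ = 0 := by
    rcases h0τ.eq_or_lt with h | h
    · rw [← h, hw0]
    refine tendsto_nhds_unique (hw.tendsto_left h hτT) (tendsto_const_nhds.congr' ?_)
    filter_upwards [Ioo_mem_nhdsLT h] with s hs
    exact (hlt s hs.1.le hs.2).symm
  have hle : ∀ s, 0 ≤ s → s ≤ τ → w s = 0 := fun s h1 h2 =>
    h2.eq_or_lt.elim (fun h => h ▸ hτ) (hlt s h1)
  rcases hτT.eq_or_lt with h | h
  · exact fun t ht => hle t ht.1 (ht.2.trans_eq h.symm)
  exfalso
  have hτI : τ ∈ Ico 0 T := ⟨h0τ, h⟩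
  have hnorm : IntegrableOn (fun u => ‖β u‖) (Ico 0 T) g.measure := hβ.norm
  have e1 := (tendsto_integral_Ioo hnorm hτI).eventually (gt_mem_nhds (one_half_pos (α := ℝ)))
  obtain ⟨δ, hδ, Hδ⟩ := hw.exists_forall_lt one_pos
  have e2 := (g.tendsto_nhdsGT τ).eventually
    (gt_mem_nhds (lt_add_of_pos_right (g τ + g.jump τ) hδ))
  obtain ⟨s, ⟨hs1, hs2⟩, hs⟩ := ((e1.and e2).and (Ioo_mem_nhdsGT h)).exists
  -- This makes M finite: g varies by less than δ on (τ, s], whatever its jump at τ.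
  have hb1 : ∀ r ∈ Ioc τ s, ‖w r‖ ≤ ‖w s‖ + 1 := by
    intro r hr
    rcases hr.2.eq_or_lt with h1 | h1
    · rw [h1]; linarith
    have h2 : g τ + g.jump τ ≤ g r := by
      have : Function.rightLim g τ ≤ g r := g.mono.rightLim_le hr.1
      simpa [jump] using this
    have h3 := Hδ r s (h0τ.trans hr.1.le) h1 hs.2.le (by linarith)
    have h4 := norm_sub_norm_le (w r) (w s)
    rw [norm_sub_rev] at h4
    linarith
  set W : Set ℝ := (fun r => ‖w r‖) '' Ioc τ s
  have hWb : BddAbove W := ⟨‖w s‖ + 1, by rintro _ ⟨r, hr, rfl⟩; exact hb1 r hr⟩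
  set M := sSup W
  have hM : ∀ r ∈ Ioc τ s, ‖w r‖ ≤ M := fun r hr => le_csSup hWb ⟨r, hr, rfl⟩
  have hM0 : 0 ≤ M := (norm_nonneg _).trans (hM s ⟨hs.1, le_rfl⟩)
  have hMr : ∀ r ∈ Ioc τ s, ‖w r‖ ≤ M / 2 := by
    intro r hr
    -- A possible atom at τ may be dropped because w(τ) = 0.
    set k : ℝ → ℝ := (Ioi τ).indicator fun u => M * ‖β u‖
    have hk : IntegrableOn k (Ico 0 T) g.measure := (hnorm.const_mul M).indicator measurableSet_Ioi
    have hk0 : ∀ t, 0 ≤ k t := fun t => indicator_nonneg (fun u _ => by positivity) t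
    have h1 := hw.norm_sub_le_integral hk hk0 h0τ hr.1.le (hr.2.trans hs.2.le) (by
      filter_upwards [hd, ae_restrict_mem measurableSet_Ico] with t h1 h2 h3 ε hε
      filter_upwards [hw.eventually_norm_sub_sub_le h2 h1 hε, self_mem_nhdsWithin] with u hu htu
      have hgu : 0 ≤ g u - g t := sub_nonneg.2 (g.mono (le_of_lt htu))
      have h4 : ‖β t * w t‖ ≤ k t := by
        rcases h3.1.eq_or_lt with h5 | h5
        · rw [← h5, hτ]; simpa using hk0 τ
        · have : k t = M * ‖β t‖ := indicator_of_mem (s := Ioi τ) h5 _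
          rw [this, norm_mul, mul_comm]
          exact mul_le_mul_of_nonneg_right (hM t ⟨h5, h3.2.le.trans hr.2⟩) (norm_nonneg _)
      calc ‖w u - w t‖ ≤ ‖w u - w t - β t * w t * ((g u - g t : ℝ) : 𝕜)‖
            + ‖β t * w t * ((g u - g t : ℝ) : 𝕜)‖ := norm_le_norm_sub_add _ _
        _ ≤ ε * (g u - g t) + k t * (g u - g t) := by
            refine add_le_add hu ?_
            rw [norm_mul, RCLike.norm_ofReal, abs_of_nonneg hgu]
            exact mul_le_mul_of_nonneg_right h4 hgu
        _ = (k t + ε) * (g u - g t) := by ring)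
      (ae_eventually_le_integral_sub hg0 hT hk)
    rw [hτ, sub_zero, setIntegral_indicator measurableSet_Ioi] at h1
    have h2 : Ico τ r ∩ Ioi τ = Ioo τ r := by
      ext x
      exact ⟨fun h => ⟨h.2, h.1.2⟩, fun h => ⟨⟨h.1.le, h.2⟩, h.1⟩⟩
    rw [h2, integral_const_mul] at h1
    have h3 : ∫ u in Ioo τ r, ‖β u‖ ∂g.measure ≤ ∫ u in Ioo τ s, ‖β u‖ ∂g.measure :=
      setIntegral_mono_set (hnorm.mono_set fun x hx => ⟨h0τ.trans hx.1.le, hx.2.trans hs.2⟩)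
        (.of_forall fun u => norm_nonneg _) (Ioo_subset_Ioo_right hr.2).eventuallyLE
    calc ‖w r‖ ≤ M * (1 / 2) := h1.trans (mul_le_mul_of_nonneg_left (h3.trans hs1.le) hM0)
      _ = M / 2 := by ring
  have hM2 : M ≤ M / 2 := csSup_le ⟨_, s, ⟨hs.1, le_rfl⟩, rfl⟩ (by rintro _ ⟨r, hr, rfl⟩; exact hMr r hr)
  have hMz : M = 0 := by linarith
  have hsS : s ∈ S := by
    refine ⟨⟨h0τ.trans hs.1.le, hs.2.le⟩, fun r hr => ?_⟩
    rcases le_or_gt r τ with h1 | h1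
    · exact hle r hr.1 h1
    · exact norm_le_zero_iff.1 ((hM r ⟨h1, hr.2⟩).trans_eq hMz)
  exact absurd (le_csSup hbdd hsS) (not_le.2 hs.1)

theorem IsExp.eqOn (hg0 : g 0 = 0) (hT : 0 < T) (hβ : IntegrableOn β (Ico 0 T) g.measure)
    {v v' : ℝ → 𝕜} (hv : g.IsExp T β v) (hv' : g.IsExp T β v') : EqOn v v' (Icc 0 T) := by
  intro t ht
  refine sub_eq_zero.1 ((hv.absCont.sub hv'.absCont).eq_zero_of_hasDerivAt hg0 hT hβ ?_ ?_ t ht)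
  · rw [hv.init, hv'.init, sub_self]
  · filter_upwards [hv.deriv, hv'.deriv] with s h1 h2
    refine ⟨h1.1, ?_⟩
    rw [mul_sub]
    refine (h1.2.sub h2.2).congr fun u => ?_
    rw [← sub_div, sub_sub_sub_comm]

end Derivator

/-! ### The product formula and existence -/

namespace Derivator

section ScalarExp

variable {𝕜 : Type*} [RCLike 𝕜]

/-- The exponential function of `𝕜` in polar form. -/
noncomputable def scalarExp (z : 𝕜) : 𝕜 :=
  (Real.exp (RCLike.re z) : 𝕜) *
    ((Real.cos (RCLike.im z) : 𝕜) + RCLike.I * (Real.sin (RCLike.im z) : 𝕜))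

/-- Covers the real case, in which `RCLike.I` is 0. -/
theorem I_eq_zero_imp_im_eq_zero (h : (RCLike.I : 𝕜) = 0) (z : 𝕜) : RCLike.im z = 0 := by
  have := RCLike.I_im z
  rw [h, map_zero, mul_zero] at this
  exact this.symm

theorem scalarExp_zero : scalarExp (0 : 𝕜) = 1 := by simp [scalarExp]

theorem scalarExp_add (z w : 𝕜) : scalarExp (z + w) = scalarExp z * scalarExp w := by
  have hI : (RCLike.I : 𝕜) * RCLike.I * ((Real.sin (RCLike.im z) : 𝕜) * (Real.sin (RCLike.im w) : 𝕜))
      = -((Real.sin (RCLike.im z) : 𝕜) * (Real.sin (RCLike.im w) : 𝕜)) := by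
    rcases RCLike.I_mul_I_ax (K := 𝕜) with h | h
    · simp [I_eq_zero_imp_im_eq_zero h]
    · rw [h, neg_one_mul]
  simp only [scalarExp, map_add, Real.exp_add, Real.cos_add, Real.sin_add, RCLike.ofReal_mul,
    RCLike.ofReal_sub]
  linear_combination (-(Real.exp (RCLike.re z) : 𝕜) * (Real.exp (RCLike.re w) : 𝕜)) * hI

theorem norm_map_complex (z : 𝕜) : ‖RCLike.map 𝕜 ℂ z‖ = ‖z‖ := by
  rw [← sq_eq_sq₀ (norm_nonneg _) (norm_nonneg _), RCLike.norm_sq_eq_def, RCLike.norm_sq_eq_def]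
  simp [RCLike.map_apply]

theorem map_complex_scalarExp (z : 𝕜) :
    RCLike.map 𝕜 ℂ (scalarExp z) = Complex.exp (RCLike.map 𝕜 ℂ z) := by
  have him : RCLike.im (RCLike.I : 𝕜) * Real.sin (RCLike.im z) = Real.sin (RCLike.im z) := by
    rcases eq_or_ne (RCLike.im z) 0 with h | h
    · simp [h]
    · have : RCLike.im (RCLike.I : 𝕜) = 1 :=
        mul_right_cancel₀ h (by rw [RCLike.I_im', one_mul])
      rw [this, one_mul]
  have hz : ∀ w : 𝕜, RCLike.map 𝕜 ℂ w = ⟨RCLike.re w, RCLike.im w⟩ := fun w => by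
    apply Complex.ext <;> simp [RCLike.map_apply]
  rw [hz, hz]
  apply Complex.ext
  · simp [scalarExp, Complex.exp_re]
  · simp [scalarExp, Complex.exp_im, him]

/-- `A` is close to `1 + a` to the order at which `exp a` is, with `p` a majorant of `a`. -/
def ExpClose (A a : 𝕜) (p : ℝ) : Prop := ‖a‖ ≤ p ∧ ‖A - 1 - a‖ ≤ Real.exp p - 1 - p

namespace ExpClose

variable {A B a b : 𝕜} {p q : ℝ}

theorem norm_sub_one_le (h : ExpClose A a p) : ‖A - 1‖ ≤ Real.exp p - 1 := by
  have := norm_le_norm_sub_add (A - 1) a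
  linarith [h.1, h.2]

theorem norm_le (h : ExpClose A a p) : ‖A‖ ≤ Real.exp p := by
  have := norm_le_norm_sub_add A 1
  rw [norm_one] at this
  linarith [h.norm_sub_one_le]

/-- The splitting of AB - 1 - (a + b) used here has an exact counterpart for the majorants: (e^p - 1
- p)e^q + (1 + p)(e^q - 1 - q) + pq = e^(p+q) - 1 - (p + q). -/
theorem mul (hA : ExpClose A a p) (hB : ExpClose B b q) : ExpClose (A * B) (a + b) (p + q) := by
  refine ⟨(norm_add_le _ _).trans (add_le_add hA.1 hB.1), ?_⟩
  have hp : 0 ≤ p := (norm_nonneg _).trans hA.1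
  have hq : 0 ≤ q := (norm_nonneg _).trans hB.1
  have h0 : A * B - 1 - (a + b) = (A - 1 - a) * B + (1 + a) * (B - 1 - b) + a * b := by ring
  have h1 : ‖(A - 1 - a) * B‖ ≤ (Real.exp p - 1 - p) * Real.exp q := by
    rw [norm_mul]
    exact mul_le_mul hA.2 hB.norm_le (norm_nonneg _) ((norm_nonneg _).trans hA.2)
  have h2 : ‖(1 + a) * (B - 1 - b)‖ ≤ (1 + p) * (Real.exp q - 1 - q) := by
    rw [norm_mul]
    refine mul_le_mul ((norm_add_le _ _).trans ?_) hB.2 (norm_nonneg _) (by linarith)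
    rw [norm_one]; linarith [hA.1]
  have h3 : ‖a * b‖ ≤ p * q := by
    rw [norm_mul]; exact mul_le_mul hA.1 hB.1 (norm_nonneg _) hp
  rw [h0, Real.exp_add]
  refine (norm_add₃_le).trans ?_
  nlinarith

theorem one_add (x : 𝕜) : ExpClose (1 + x) x ‖x‖ := by
  refine ⟨le_rfl, ?_⟩
  have : 1 + x - 1 - x = 0 := by ring
  rw [this, norm_zero]
  linarith [Real.add_one_le_exp ‖x‖]

theorem scalarExp (z : 𝕜) : ExpClose (scalarExp z) z ‖z‖ := by
  refine ⟨le_rfl, ?_⟩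
  have h := Complex.norm_exp_sub_sum_le_exp_norm_sub_sum (RCLike.map 𝕜 ℂ z) 2
  have h1 : RCLike.map 𝕜 ℂ (1 : 𝕜) = 1 := by simp [RCLike.map_apply]
  simp only [Finset.sum_range_succ, Finset.sum_range_zero, zero_add, pow_zero, pow_one,
    Nat.factorial_zero, Nat.factorial_one, Nat.cast_one, div_one, ← sub_sub] at h
  rw [← map_complex_scalarExp, ← h1, ← map_sub, ← map_sub, norm_map_complex, norm_map_complex] at h
  exact h

theorem mono (h : ExpClose A a p) (hpq : p ≤ q) : ExpClose A a q := by
  refine ⟨h.1.trans hpq, h.2.trans ?_⟩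
  have hp : 0 ≤ p := (norm_nonneg _).trans h.1
  have h1 : Real.exp q = Real.exp p * Real.exp (q - p) := by rw [← Real.exp_add]; ring_nf
  have h2 := Real.add_one_le_exp (q - p)
  have h3 := Real.one_le_exp hp
  nlinarith [Real.exp_pos p]

theorem prod {ι : Type*} (x : ι → 𝕜) (s : Finset ι) :
    ExpClose (∏ i ∈ s, (1 + x i)) (∑ i ∈ s, x i) (∑ i ∈ s, ‖x i‖) := by
  classical
  induction s using Finset.induction_on with
  | empty => simp [ExpClose]
  | insert i s hi ih =>
    rw [Finset.prod_insert hi, Finset.sum_insert hi, Finset.sum_insert hi]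
    exact (one_add (x i)).mul ih

theorem hasProd {ι : Type*} {x : ι → 𝕜} (hA : HasProd (fun i => 1 + x i) A) (ha : HasSum x a)
    (hp : HasSum (fun i => ‖x i‖) p) : ExpClose A a p := by
  refine ⟨le_of_tendsto_of_tendsto' ha.norm hp fun s => (prod x s).1,
    le_of_tendsto_of_tendsto' ((Tendsto.sub_const hA 1).sub ha).norm
      (((Real.continuous_exp.tendsto p).comp hp |>.sub_const 1).sub hp) fun s => (prod x s).2⟩

theorem norm_sub_one_le_mul (h : ExpClose A a p) : ‖A - 1‖ ≤ p * Real.exp p := by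
  refine h.norm_sub_one_le.trans ?_
  have h1 := Real.add_one_le_exp (-p)
  have h2 : Real.exp (-p) * Real.exp p = 1 := by rw [← Real.exp_add]; simp
  nlinarith [Real.exp_pos p]

theorem norm_sub_sub_le_sq (h : ExpClose A a p) : ‖A - 1 - a‖ ≤ p ^ 2 * Real.exp p := by
  refine h.2.trans ?_
  have hp : 0 ≤ p := (norm_nonneg _).trans h.1
  have h1 := Real.add_one_le_exp (-p)
  have h2 : Real.exp (-p) * Real.exp p = 1 := by rw [← Real.exp_add]; simp
  have h3 : Real.exp p - 1 ≤ p * Real.exp p := by nlinarith [Real.exp_pos p]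
  nlinarith [mul_le_mul_of_nonneg_left h3 hp]

end ExpClose

end ScalarExp

variable {𝕜 : Type*} [RCLike 𝕜] {g : Derivator} {T : ℝ} {β : ℝ → 𝕜} {S S' : Set ℝ}

/-- The relative increments `β Δ⁺g` at the jumps in `S`. -/
noncomputable def jumpTerm (g : Derivator) (β : ℝ → 𝕜) (S : Set ℝ) (u : ℝ) : 𝕜 :=
  (S ∩ g.D).indicator (fun u => β u * (g.jump u : 𝕜)) u

/-- The factor by which the `g`-exponential changes across the set `S`. -/
noncomputable def expFactor (g : Derivator) (β : ℝ → 𝕜) (S : Set ℝ) : 𝕜 :=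
  (∏' u, (1 + g.jumpTerm β S u)) * scalarExp (∫ u in S \ g.D, β u ∂g.measure)

/-- D is countable and the atom at u has mass Δ⁺g(u), so the integral over S ∩ D is a sum. -/
theorem hasSum_jumpTerm (hβ : IntegrableOn β S g.measure) :
    HasSum (g.jumpTerm β S) (∫ u in S ∩ g.D, β u ∂g.measure) := by
  have hc : (S ∩ g.D).Countable := g.countable_D.mono inter_subset_right
  have := hc.to_subtype
  have hU : (⋃ i : ↥(S ∩ g.D), {(i : ℝ)}) = S ∩ g.D := iUnion_of_singleton_coe _
  have h1 := hasSum_integral_iUnion (μ := g.measure) (f := β) (s := fun i : ↥(S ∩ g.D) => {(i : ℝ)})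
    (fun i => measurableSet_singleton _)
    (fun i j hij => by
      simpa [Function.onFun, Subtype.ext_iff] using fun h => hij (Subtype.ext h))
    (by rw [hU]; exact hβ.mono_set inter_subset_left)
  rw [hU] at h1
  unfold jumpTerm
  rw [← hasSum_subtype_iff_indicator]
  refine h1.congr_fun ?_
  intro i
  rw [integral_singleton, measureReal_singleton, RCLike.real_smul_eq_coe_mul, mul_comm]
  rfl

theorem norm_jumpTerm (u : ℝ) : ‖g.jumpTerm β S u‖ = g.jumpTerm (fun u => ‖β u‖) S u := by
  rw [jumpTerm, jumpTerm, norm_indicator_eq_indicator_norm]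
  simp [abs_of_nonneg (g.jump_nonneg _)]

theorem hasSum_norm_jumpTerm (hβ : IntegrableOn β S g.measure) :
    HasSum (fun u => ‖g.jumpTerm β S u‖) (∫ u in S ∩ g.D, ‖β u‖ ∂g.measure) := by
  simp only [norm_jumpTerm]
  exact hasSum_jumpTerm (β := fun u => ‖β u‖) hβ.norm

theorem multipliable_jumpTerm (hβ : IntegrableOn β S g.measure) :
    Multipliable fun u => 1 + g.jumpTerm β S u :=
  multipliable_one_add_of_summable (hasSum_norm_jumpTerm hβ).summable

theorem expClose_expFactor (hβ : IntegrableOn β S g.measure) :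
    ExpClose (g.expFactor β S) (∫ u in S, β u ∂g.measure) (∫ u in S, ‖β u‖ ∂g.measure) := by
  rw [← integral_inter_add_sdiff g.measurableSet_D hβ,
    ← integral_inter_add_sdiff g.measurableSet_D hβ.norm]
  exact (ExpClose.hasProd (multipliable_jumpTerm hβ).hasProd (hasSum_jumpTerm hβ)
    (hasSum_norm_jumpTerm hβ)).mul
    ((ExpClose.scalarExp _).mono (norm_integral_le_integral_norm _))

theorem expFactor_union (hβ : IntegrableOn β (S ∪ S') g.measure) (hS' : MeasurableSet S')
    (hd : Disjoint S S') :
    g.expFactor β (S ∪ S') = g.expFactor β S * g.expFactor β S' := by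
  have hβ₁ := hβ.mono_set subset_union_left
  have hβ₂ := hβ.mono_set subset_union_right
  have h1 : ∀ u, 1 + g.jumpTerm β (S ∪ S') u = (1 + g.jumpTerm β S u) * (1 + g.jumpTerm β S' u) := by
    intro u
    have hdu := fun h : u ∈ S => Set.disjoint_left.1 hd h
    by_cases hD : u ∈ g.D <;> by_cases h1 : u ∈ S <;> by_cases h2 : u ∈ S' <;>
      simp [jumpTerm, indicator, hD, h1, h2]
    exact absurd h2 (hdu h1)
  simp only [expFactor, h1]
  rw [(multipliable_jumpTerm hβ₁).tprod_mul (multipliable_jumpTerm hβ₂), union_sdiff_distrib,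
    setIntegral_union (hd.mono sdiff_subset sdiff_subset) (hS'.diff g.measurableSet_D)
      (hβ₁.mono_set sdiff_subset) (hβ₂.mono_set sdiff_subset), scalarExp_add]
  ring

theorem expFactor_empty : g.expFactor β ∅ = 1 := by
  simp [expFactor, jumpTerm, scalarExp_zero]

theorem expFactor_singleton {t : ℝ} (ht : t ∈ g.D) :
    g.expFactor β {t} = 1 + β t * (g.jump t : 𝕜) := by
  have h1 : ({t} : Set ℝ) \ g.D = ∅ := sdiff_eq_empty.2 (singleton_subset_iff.2 ht)
  rw [expFactor, h1, setIntegral_empty, scalarExp_zero, mul_one, tprod_eq_mulSingle t]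
  · simp [jumpTerm, ht]
  · intro u hu
    simp [jumpTerm, hu]

theorem expFactor_Ico {r t s : ℝ} (hβ : IntegrableOn β (Ico r s) g.measure) (hrt : r ≤ t)
    (hts : t ≤ s) :
    g.expFactor β (Ico r s) = g.expFactor β (Ico r t) * g.expFactor β (Ico t s) := by
  rw [← Ico_union_Ico_eq_Ico hrt hts] at hβ ⊢
  exact expFactor_union hβ measurableSet_Ico Ico_disjoint_Ico_same

theorem norm_expFactor_le (hβ : IntegrableOn β (Ico 0 T) g.measure) (hS : S ⊆ Ico 0 T) :
    ‖g.expFactor β S‖ ≤ Real.exp (∫ u in Ico 0 T, ‖β u‖ ∂g.measure) := by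
  refine (expClose_expFactor (hβ.mono_set hS)).norm_le.trans (Real.exp_le_exp.2 ?_)
  exact setIntegral_mono_set hβ.norm (.of_forall fun u => norm_nonneg _) hS.eventuallyLE

theorem absCont_expFactor (hβ : IntegrableOn β (Ico 0 T) g.measure) :
    g.AbsCont 0 T (fun t => g.expFactor β (Ico 0 t)) := by
  set C := Real.exp (∫ u in Ico 0 T, ‖β u‖ ∂g.measure)
  refine absCont_of_norm_sub_le (k := fun u => ‖β u‖) (C := C * C) hβ.norm fun l r hl hlr hr => ?_
  have hsub : Ico l r ⊆ Ico 0 T := Ico_subset_Ico hl hr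
  have hM0 : 0 ≤ ∫ u in Ico l r, ‖β u‖ ∂g.measure := by positivity
  have hMC : Real.exp (∫ u in Ico l r, ‖β u‖ ∂g.measure) ≤ C := Real.exp_le_exp.2 <|
    setIntegral_mono_set hβ.norm (.of_forall fun u => norm_nonneg _) hsub.eventuallyLE
  rw [expFactor_Ico (hβ.mono_set (Ico_subset_Ico_right hr)) hl hlr.le, ← mul_sub_one, norm_mul,
    mul_assoc]
  refine mul_le_mul (norm_expFactor_le hβ (Ico_subset_Ico_right (hlr.le.trans hr))) ?_
    (norm_nonneg _) (Real.exp_pos _).le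
  refine (expClose_expFactor (hβ.mono_set hsub)).norm_sub_one_le_mul.trans ?_
  rw [mul_comm]
  exact mul_le_mul_of_nonneg_right hMC hM0

/-- Both orders of s and t are needed, since the derivative at a continuity point can be two-sided.
For s < t the linear term is based at the right end; moving it to the left end costs a second
quadratic error, hence the factor 2. -/
theorem norm_expFactor_sub_sub_le (hβ : IntegrableOn β (Ico 0 T) g.measure) {s t : ℝ}
    (hs : s ∈ Icc 0 T) (ht : t ∈ Icc 0 T) :
    ‖g.expFactor β (Ico 0 s) - g.expFactor β (Ico 0 t) - g.expFactor β (Ico 0 t) *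
        ((∫ u in Ico 0 s, β u ∂g.measure) - ∫ u in Ico 0 t, β u ∂g.measure)‖ ≤
      2 * Real.exp (∫ u in Ico 0 T, ‖β u‖ ∂g.measure) ^ 2 *
        ((∫ u in Ico 0 s, ‖β u‖ ∂g.measure) - ∫ u in Ico 0 t, ‖β u‖ ∂g.measure) ^ 2 := by
  set C := Real.exp (∫ u in Ico 0 T, ‖β u‖ ∂g.measure)
  have hC : 0 < C := Real.exp_pos _
  have key : ∀ l r, 0 ≤ l → l ≤ r → r ≤ T →
      0 ≤ (∫ u in Ico l r, ‖β u‖ ∂g.measure) ∧ ‖g.expFactor β (Ico 0 l)‖ ≤ C ∧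
      ‖∫ u in Ico l r, β u ∂g.measure‖ ≤ ∫ u in Ico l r, ‖β u‖ ∂g.measure ∧
      ‖g.expFactor β (Ico l r) - 1‖ ≤ (∫ u in Ico l r, ‖β u‖ ∂g.measure) * C ∧
      ‖g.expFactor β (Ico l r) - 1 - ∫ u in Ico l r, β u ∂g.measure‖ ≤
        (∫ u in Ico l r, ‖β u‖ ∂g.measure) ^ 2 * C := by
    intro l r hl hlr hr
    have hsub : Ico l r ⊆ Ico 0 T := Ico_subset_Ico hl hr
    have hM0 : 0 ≤ ∫ u in Ico l r, ‖β u‖ ∂g.measure := by positivity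
    have hMC : Real.exp (∫ u in Ico l r, ‖β u‖ ∂g.measure) ≤ C := Real.exp_le_exp.2 <|
      setIntegral_mono_set hβ.norm (.of_forall fun u => norm_nonneg _) hsub.eventuallyLE
    have hE := expClose_expFactor (hβ.mono_set hsub)
    exact ⟨hM0, norm_expFactor_le hβ (Ico_subset_Ico_right (hlr.trans hr)), hE.1,
      hE.norm_sub_one_le_mul.trans (mul_le_mul_of_nonneg_left hMC hM0),
      hE.norm_sub_sub_le_sq.trans (mul_le_mul_of_nonneg_left hMC (sq_nonneg _))⟩
  rcases le_total t s with h | h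
  · obtain ⟨k1, k2, k3, k4, k5⟩ := key t s ht.1 h hs.2
    rw [integral_Ico_sub hβ ht.1 h hs.2,
      integral_Ico_sub (f := fun u => ‖β u‖) hβ.norm ht.1 h hs.2,
      expFactor_Ico (hβ.mono_set (Ico_subset_Ico_right hs.2)) ht.1 h, ← mul_sub_one, ← mul_sub,
      norm_mul]
    have := mul_le_mul k2 k5 (norm_nonneg _) hC.le
    nlinarith [mul_nonneg (sq_nonneg C) (sq_nonneg (∫ u in Ico t s, ‖β u‖ ∂g.measure))]
  · obtain ⟨k1, k2, k3, k4, k5⟩ := key s t hs.1 h ht.2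
    have e1 := integral_Ico_sub hβ hs.1 h ht.2
    have e2 := integral_Ico_sub (f := fun u => ‖β u‖) hβ.norm hs.1 h ht.2
    rw [← neg_sub (∫ u in Ico 0 t, β u ∂g.measure), e1, ← neg_sub (∫ u in Ico 0 t, ‖β u‖ ∂g.measure), e2, neg_sq,
      expFactor_Ico (hβ.mono_set (Ico_subset_Ico_right ht.2)) hs.1 h]
    set A := g.expFactor β (Ico 0 s)
    set P := g.expFactor β (Ico s t)
    set b := ∫ u in Ico s t, β u ∂g.measure
    set M := ∫ u in Ico s t, ‖β u‖ ∂g.measure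
    have h0 : A - A * P - A * P * -b = A * ((P - 1) * b - (P - 1 - b)) := by ring
    rw [h0, norm_mul]
    have h1 : ‖(P - 1) * b - (P - 1 - b)‖ ≤ M * C * M + M ^ 2 * C := by
      refine (norm_sub_le _ _).trans (add_le_add ?_ k5)
      rw [norm_mul]
      exact mul_le_mul k4 k3 (norm_nonneg _) (by positivity)
    refine (mul_le_mul k2 h1 (norm_nonneg _) hC.le).trans_eq ?_
    ring

theorem tendsto_expFactor_Ioo (hβ : IntegrableOn β (Ico 0 T) g.measure) {t : ℝ}
    (ht : t ∈ Ico 0 T) : Tendsto (fun s => g.expFactor β (Ioo t s)) (𝓝[>] t) (𝓝 1) := by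
  rw [tendsto_iff_norm_sub_tendsto_zero]
  have h1 : Tendsto (fun s => Real.exp (∫ u in Ioo t s, ‖β u‖ ∂g.measure) - 1) (𝓝[>] t) (𝓝 0) := by
    have h2 := ((Real.continuous_exp.tendsto 0).comp
      (tendsto_integral_Ioo (f := fun u => ‖β u‖) hβ.norm ht)).sub_const 1
    simpa using h2
  refine squeeze_zero' (.of_forall fun _ => norm_nonneg _) ?_ h1
  filter_upwards [Ioo_mem_nhdsGT ht.2] with s hs
  exact (expClose_expFactor
    (hβ.mono_set fun u hu => ⟨ht.1.trans hu.1.le, hu.2.trans hs.2⟩)).norm_sub_one_le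

/-- The product formula solves the initial value problem of the `g`-exponential. -/
theorem isExp_expFactor (hg0 : g 0 = 0) (hT : 0 < T) (hβ : IntegrableOn β (Ico 0 T) g.measure) :
    g.IsExp T β (fun t => g.expFactor β (Ico 0 t)) := by
  refine ⟨absCont_expFactor hβ, by simp [expFactor_empty], ?_⟩
  filter_upwards [ae_hasDerivAt_integral hg0 hT hβ,
    ae_hasDerivAt_integral (f := fun u => ‖β u‖) hg0 hT hβ.norm,
    ae_restrict_mem measurableSet_Ico] with t hB hK hts
  refine ⟨hB.1, ?_⟩
  set E : ℝ → 𝕜 := fun t => g.expFactor β (Ico 0 t)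
  by_cases hD : t ∈ g.D
  · rw [derivFilter_of_mem_D hD, nhdsWithin_Ioc_eq_nhdsGT hts.2]
    have hj : (g.jump t : 𝕜) ≠ 0 := by
      have : 0 < g.jump t := hD
      exact_mod_cast this.ne'
    -- Multiplicativity splits [t, s) into the atom {t} and (t, s), whose factor tends to 1.
    have h1 : Tendsto (fun s => E t * ((1 + β t * (g.jump t : 𝕜)) * g.expFactor β (Ioo t s)) - E t)
        (𝓝[>] t) (𝓝 (E t * ((1 + β t * (g.jump t : 𝕜)) * 1) - E t)) :=
      (((tendsto_expFactor_Ioo hβ hts).const_mul _).const_mul _).sub_const _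
    have h2 : Tendsto (fun s => ((g s - g t : ℝ) : 𝕜)) (𝓝[>] t) (𝓝 (g.jump t : 𝕜)) := by
      refine (RCLike.continuous_ofReal.tendsto _).comp ?_
      simpa using (g.tendsto_nhdsGT t).sub_const (g t)
    have h3 := h1.div h2 hj
    have h4 : (E t * ((1 + β t * (g.jump t : 𝕜)) * 1) - E t) / (g.jump t : 𝕜) = β t * E t := by
      field_simp; ring
    rw [h4] at h3
    refine h3.congr' ?_
    filter_upwards [Ioo_mem_nhdsGT hts.2] with s hs
    have h5 : IntegrableOn β (Ico 0 s) g.measure := hβ.mono_set (Ico_subset_Ico_right hs.2.le)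
    have h6 : Ico t s = {t} ∪ Ioo t s := by rw [singleton_union, Ioo_insert_left hs.1]
    have h7 : IntegrableOn β (Ico t s) g.measure := h5.mono_set (Ico_subset_Ico_left hts.1)
    rw [h6] at h7
    rw [Pi.div_apply]
    simp only [E]
    rw [expFactor_Ico h5 hts.1 hs.1.le, h6, expFactor_union h7 measurableSet_Ioo (by simp),
      expFactor_singleton hD]
  · have hB2 := hB.2
    have hK2 := hK.2
    rw [derivFilter_of_notMem_D hD] at hB2 hK2 ⊢
    set F := 𝓝[{s | s ∈ Icc 0 T ∧ g s ≠ g t}] t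
    set C := Real.exp (∫ u in Ico 0 T, ‖β u‖ ∂g.measure)
    simp only [RCLike.ofReal_real_eq_id, id_eq] at hK2
    have hg : Tendsto (fun s => |g s - g t|) F (𝓝 0) := by
      have : Tendsto g F (𝓝 (g t)) := (continuousAt_of_notMem_D hD).mono_left nhdsWithin_le_nhds
      simpa using (this.sub_const (g t)).abs
    -- The quadratic error divided by |g(s) - g(t)| is a constant times the square of the difference
    -- quotient of ∫|β|, which converges, times |g(s) - g(t)|, which tends to 0.
    have hR : Tendsto (fun s => (E s - E t) / ((g s - g t : ℝ) : 𝕜) - E t *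
        (((∫ u in Ico 0 s, β u ∂g.measure) - ∫ u in Ico 0 t, β u ∂g.measure) /
          ((g s - g t : ℝ) : 𝕜))) F (𝓝 0) := by
      have h1 := ((hK2.pow 2).const_mul (2 * C ^ 2)).mul hg
      rw [mul_zero] at h1
      refine squeeze_zero_norm' ?_ h1
      filter_upwards [self_mem_nhdsWithin] with s hs
      have h0 : 0 < |g s - g t| := abs_pos.2 (sub_ne_zero.2 hs.2)
      rw [← mul_div_assoc, ← sub_div, norm_div, RCLike.norm_ofReal, div_le_iff₀ h0]
      refine (norm_expFactor_sub_sub_le hβ hs.1 ⟨hts.1, hts.2.le⟩).trans_eq ?_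
      have h2 : g s - g t ≠ 0 := sub_ne_zero.2 hs.2
      rw [div_pow, mul_assoc _ |g s - g t|, abs_mul_abs_self]
      field_simp
      simp only [C]
      ring
    have h2 := hR.add (hB2.const_mul (E t))
    rw [zero_add, mul_comm] at h2
    refine h2.congr fun s => ?_
    rw [sub_add_cancel]

theorem isExp_exp (hg0 : g 0 = 0) (hT : 0 < T) (hβ : IntegrableOn β (Ico 0 T) g.measure) :
    g.IsExp T β (g.exp T β) :=
  Classical.epsilon_spec ⟨_, isExp_expFactor hg0 hT hβ⟩

theorem exp_eq_expFactor (hg0 : g 0 = 0) (hT : 0 < T) (hβ : IntegrableOn β (Ico 0 T) g.measure)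
    {t : ℝ} (ht : t ∈ Icc 0 T) : g.exp T β t = g.expFactor β (Ico 0 t) :=
  (isExp_exp hg0 hT hβ).eqOn hg0 hT hβ (isExp_expFactor hg0 hT hβ) ht

end Derivator

/-! ### The continuous part of g and its pseudo-inverse -/

namespace Derivator

section ContPart

variable {g : Derivator} {T : ℝ}

theorem contPart_eq_measureReal (hg0 : g 0 = 0) {t : ℝ} (ht : 0 ≤ t) :
    g.contPart t = g.measure.real (Ico 0 t \ g.D) := by
  have h1 : IntegrableOn (fun _ : ℝ => (1 : ℝ)) (Ico 0 t) g.measure :=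
    integrableOn_const (g.measure_Ico_ne_top 0 t)
  have h2 := integral_inter_add_sdiff g.measurableSet_D h1
  simp only [setIntegral_const, smul_eq_mul, mul_one, measureReal_Ico g ht, hg0, sub_zero] at h2
  have h3 : g.jumpPart t = g.measure.real (Ico 0 t ∩ g.D) := by
    rcases ht.eq_or_lt with rfl | h0
    · have : IsEmpty ↥(Ico (0 : ℝ) 0 ∩ g.D) := by simp
      rw [jumpPart, if_neg (lt_irrefl _), tsum_empty]
      simp
    · have h4 := (hasSum_jumpTerm h1).tsum_eq
      simp only [jumpTerm, one_mul, RCLike.ofReal_real_eq_id, id_eq, setIntegral_const, smul_eq_mul,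
        mul_one] at h4
      rw [jumpPart, if_pos h0, ← h4, ← tsum_subtype]
  rw [contPart, h3, ← h2, add_sub_cancel_left]

instance nullSingletonClass_restrict_sdiff_D (S : Set ℝ) :
    NullSingletonClass (g.measure.restrict (S \ g.D)) := by
  refine ⟨fun x => ?_⟩
  rw [Measure.restrict_apply (measurableSet_singleton x)]
  by_cases hx : x ∈ g.D
  · have : {x} ∩ (S \ g.D) = ∅ := by ext y; simp; rintro rfl _; exact hx
    rw [this, measure_empty]
  · refine measure_mono_null inter_subset_left ?_
    rw [measure_singleton, jump_eq_zero hx, ENNReal.ofReal_zero]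

instance isFiniteMeasure_restrict_Ico_sdiff (a b : ℝ) (S : Set ℝ) :
    IsFiniteMeasure (g.measure.restrict (Ico a b \ S)) :=
  isFiniteMeasure_restrict.2
    (ne_top_of_le_ne_top (g.measure_Ico_ne_top a b) (measure_mono sdiff_subset))

theorem continuousOn_contPart (hg0 : g 0 = 0) : ContinuousOn g.contPart (Icc 0 T) := by
  have h1 := intervalIntegral.continuousOn_primitive (μ := g.measure.restrict (Ico 0 T \ g.D))
    (f := fun _ => (1 : ℝ)) (a := 0) (b := T) (integrable_const _)
  refine h1.congr fun t ht => ?_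
  change g.contPart t = ∫ _ in Ioc 0 t, (1 : ℝ) ∂_
  rw [← integral_Ico_eq_integral_Ioc, setIntegral_const, smul_eq_mul, mul_one,
    contPart_eq_measureReal hg0 ht.1, Measure.real, Measure.real,
    Measure.restrict_apply measurableSet_Ico, ← inter_sdiff_assoc,
    inter_eq_left.2 (Ico_subset_Ico_right ht.2)]

theorem contPart_zero (hg0 : g 0 = 0) : g.contPart 0 = 0 := by
  simp [contPart_eq_measureReal hg0 le_rfl]

theorem contPart_mono (hg0 : g 0 = 0) {s t : ℝ} (hs : 0 ≤ s) (hst : s ≤ t) :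
    g.contPart s ≤ g.contPart t := by
  rw [contPart_eq_measureReal hg0 hs, contPart_eq_measureReal hg0 (hs.trans hst)]
  exact measureReal_mono (sdiff_subset_sdiff_left (Ico_subset_Ico_right hst))
    (ne_top_of_le_ne_top (g.measure_Ico_ne_top 0 t) (measure_mono sdiff_subset))

theorem isLeast_pseudoInv (hg0 : g 0 = 0) (hT : 0 ≤ T) {x : ℝ} (hx : x ∈ Icc 0 (g.contPart T)) :
    IsLeast {t | t ∈ Icc 0 T ∧ g.contPart t = x} (g.pseudoInv T x) := by
  have hc : IsClosed {t | t ∈ Icc 0 T ∧ g.contPart t = x} :=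
    (continuousOn_contPart hg0).preimage_isClosed_of_isClosed isClosed_Icc isClosed_singleton
  refine hc.isLeast_csInf ?_ ⟨0, fun t ht => ht.1.1⟩
  rw [← contPart_zero hg0] at hx
  obtain ⟨t, ht, rfl⟩ := intermediate_value_Icc hT (continuousOn_contPart hg0) hx
  exact ⟨t, ht, rfl⟩

/-- If x ≤ g^C(t), the value x is already attained on [0, t], and γ(x) is the first point where it
is. -/
theorem pseudoInv_le_iff (hg0 : g 0 = 0) (hT : 0 ≤ T) {x t : ℝ} (hx : x ∈ Icc 0 (g.contPart T))
    (ht : t ∈ Icc 0 T) : g.pseudoInv T x ≤ t ↔ x ≤ g.contPart t := by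
  obtain ⟨⟨h1, h2⟩, h3⟩ := isLeast_pseudoInv hg0 hT hx
  refine ⟨fun h => h2 ▸ contPart_mono hg0 h1.1 h, fun h => ?_⟩
  obtain ⟨⟨a1, a2⟩, -⟩ := isLeast_pseudoInv hg0 ht.1 ⟨hx.1, h⟩
  exact (h3 ⟨⟨a1.1, a1.2.trans ht.2⟩, a2⟩).trans a1.2

/-- Reduces integrals over [0, g^C(t)) to the change of variables with t in place of T. -/
theorem pseudoInv_eq_pseudoInv (hg0 : g 0 = 0) {x t : ℝ} (ht : t ∈ Icc 0 T)
    (hx : x ∈ Icc 0 (g.contPart t)) : g.pseudoInv T x = g.pseudoInv t x := by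
  have hT := ht.1.trans ht.2
  have hx' : x ∈ Icc 0 (g.contPart T) := ⟨hx.1, hx.2.trans (contPart_mono hg0 ht.1 ht.2)⟩
  obtain ⟨⟨h1, h2⟩, h3⟩ := isLeast_pseudoInv hg0 hT hx'
  obtain ⟨⟨a1, a2⟩, a3⟩ := isLeast_pseudoInv hg0 ht.1 hx
  exact le_antisymm (h3 ⟨⟨a1.1, a1.2.trans ht.2⟩, a2⟩)
    (a3 ⟨⟨h1.1, (pseudoInv_le_iff hg0 hT hx' ht).2 hx.2⟩, h2⟩)

theorem aemeasurable_pseudoInv (hg0 : g 0 = 0) (hT : 0 ≤ T) :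
    AEMeasurable (g.pseudoInv T) (volume.restrict (Ico 0 (g.contPart T))) := by
  refine aemeasurable_restrict_of_monotoneOn measurableSet_Ico fun x hx y hy hxy => ?_
  obtain ⟨⟨h1, h2⟩, -⟩ := isLeast_pseudoInv hg0 hT ⟨hy.1, hy.2.le⟩
  exact (pseudoInv_le_iff hg0 hT ⟨hx.1, hx.2.le⟩ h1).2 (hxy.trans h2.ge)

theorem map_pseudoInv (hg0 : g 0 = 0) (hT : 0 ≤ T) :
    (volume.restrict (Ico 0 (g.contPart T))).map (g.pseudoInv T)
      = g.measure.restrict (Ico 0 T \ g.D) := by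
  have hae := aemeasurable_pseudoInv hg0 hT
  have := Measure.isFiniteMeasure_map (volume.restrict (Ico 0 (g.contPart T))) (g.pseudoInv T)
  have hν : ∀ t, 0 ≤ t → ENNReal.ofReal (g.contPart t) = g.measure (Ico 0 t \ g.D) := by
    intro t ht
    rw [contPart_eq_measureReal hg0 ht, ofReal_measureReal
      (ne_top_of_le_ne_top (g.measure_Ico_ne_top 0 t) (measure_mono sdiff_subset))]
  refine Measure.ext_of_Iic _ _ fun t => ?_
  rw [Measure.map_apply_of_aemeasurable hae measurableSet_Iic,
    Measure.restrict_apply' measurableSet_Ico]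
  have hI : ∀ x ∈ Ico 0 (g.contPart T), g.pseudoInv T x ∈ Icc 0 T := fun x hx =>
    (isLeast_pseudoInv hg0 hT ⟨hx.1, hx.2.le⟩).1.1
  rcases lt_or_ge t 0 with h0 | h0
  · have e1 : g.pseudoInv T ⁻¹' Iic t ∩ Ico 0 (g.contPart T) = ∅ := by
      refine eq_empty_of_forall_notMem fun x hx => ?_
      exact absurd (((hI x hx.2).1).trans hx.1) (not_le.2 h0)
    have e2 : Iic t ∩ (Ico 0 T \ g.D) = ∅ := by
      refine eq_empty_of_forall_notMem fun x hx => ?_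
      exact absurd (hx.2.1.1.trans hx.1) (not_le.2 h0)
    rw [Measure.restrict_apply measurableSet_Iic, e1, e2, measure_empty, measure_empty]
  rcases le_or_gt t T with h1 | h1
  · have ht : t ∈ Icc 0 T := ⟨h0, h1⟩
    have hle := contPart_mono hg0 h0 h1
    have e2 : Iio t ∩ (Ico 0 T \ g.D) = Ico 0 t \ g.D := by
      ext x
      exact ⟨fun h => ⟨⟨h.2.1.1, h.1⟩, h.2.2⟩, fun h => ⟨h.1.2, ⟨h.1.1, h.1.2.trans_le h1⟩, h.2⟩⟩
    -- Off D there are no atoms, so the endpoint t is negligible. The preimage then lies between [0,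
    -- g^C(t)) and [0, g^C(t)], up to the cut at g^C(T).
    rw [← measure_congr (Iio_ae_eq_Iic (μ := g.measure.restrict (Ico 0 T \ g.D)) (a := t)),
      Measure.restrict_apply measurableSet_Iio, e2, ← hν t h0]
    apply le_antisymm
    · refine (measure_mono (t := Icc 0 (g.contPart t)) fun x hx => ?_).trans_eq (by simp)
      exact ⟨hx.2.1, (pseudoInv_le_iff hg0 hT ⟨hx.2.1, hx.2.2.le⟩ ht).1 hx.1⟩
    · refine Eq.trans_le (by simp) (measure_mono (s := Ico 0 (g.contPart t)) fun x hx => ?_)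
      have hx2 := hx.2.trans_le hle
      exact ⟨(pseudoInv_le_iff hg0 hT ⟨hx.1, hx2.le⟩ ht).2 hx.2.le, hx.1, hx2⟩
  · have e1 : g.pseudoInv T ⁻¹' Iic t ∩ Ico 0 (g.contPart T) = Ico 0 (g.contPart T) :=
      inter_eq_right.2 fun x hx => (hI x hx).2.trans h1.le
    have e2 : Iic t ∩ (Ico 0 T \ g.D) = Ico 0 T \ g.D :=
      inter_eq_right.2 fun x hx => hx.1.2.le.trans h1.le
    rw [Measure.restrict_apply measurableSet_Iic, e1, e2, ← hν T hT, Real.volume_Ico, sub_zero]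

variable {f : ℝ → ℝ}

theorem integrableOn_comp_pseudoInv (hg0 : g 0 = 0) (hf : IntegrableOn f (Ico 0 T) g.measure)
    {t : ℝ} (ht : t ∈ Icc 0 T) :
    IntegrableOn (fun x => f (g.pseudoInv T x)) (Ico 0 (g.contPart t)) ∧
      ∫ x in Ico 0 (g.contPart t), f (g.pseudoInv T x) = ∫ u in Ico 0 t \ g.D, f u ∂g.measure := by
  have hf' : Integrable f (g.measure.restrict (Ico 0 t \ g.D)) :=
    hf.mono_set (sdiff_subset.trans (Ico_subset_Ico_right ht.2))
  have hae := aemeasurable_pseudoInv hg0 ht.1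
  have hEq : EqOn (fun x => f (g.pseudoInv T x)) (fun x => f (g.pseudoInv t x))
      (Ico 0 (g.contPart t)) := fun x hx => by
    simp only [pseudoInv_eq_pseudoInv hg0 ht ⟨hx.1, hx.2.le⟩]
  rw [integrableOn_congr_fun hEq measurableSet_Ico, setIntegral_congr_fun measurableSet_Ico hEq]
  rw [← map_pseudoInv hg0 ht.1] at hf' ⊢
  have h1 := (integrable_map_measure hf'.aestronglyMeasurable hae).1 hf'
  have h2 := integral_map hae hf'.aestronglyMeasurable
  exact ⟨h1, h2.symm⟩

end ContPart

/-! ### Algebra of the product formula: products, powers, inverses, zeros -/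

variable {𝕜 : Type*} [RCLike 𝕜] {g : Derivator} {T : ℝ} {β β₁ β₂ β₃ : ℝ → 𝕜} {S : Set ℝ}

theorem one_add_jumpTerm (u : ℝ) : 1 + g.jumpTerm β S u =
    (S ∩ g.D).mulIndicator (fun u => 1 + β u * (g.jump u : 𝕜)) u := by
  by_cases hu : u ∈ S ∩ g.D
  · rw [mulIndicator_of_mem hu, jumpTerm, indicator_of_mem hu]
  · rw [mulIndicator_of_notMem hu, jumpTerm, indicator_of_notMem hu, add_zero]

theorem multipliable_subtype_jump (hβ : IntegrableOn β S g.measure) :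
    Multipliable fun u : ↥(S ∩ g.D) => 1 + β u * (g.jump u : 𝕜) := by
  have h : Multipliable ((S ∩ g.D).mulIndicator fun u => 1 + β u * (g.jump u : 𝕜)) :=
    (funext one_add_jumpTerm : (fun u => 1 + g.jumpTerm β S u) = _) ▸ multipliable_jumpTerm hβ
  exact (multipliable_subtype_iff_mulIndicator
    (f := fun u => 1 + β u * (g.jump u : 𝕜)) (s := S ∩ g.D)).2 h

theorem expFactor_eq_tprod_subtype : g.expFactor β S =
    (∏' u : ↥(S ∩ g.D), (1 + β u * (g.jump u : 𝕜))) *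
      scalarExp (∫ u in S \ g.D, β u ∂g.measure) := by
  rw [expFactor, tprod_subtype (S ∩ g.D) fun u => 1 + β u * (g.jump u : 𝕜)]
  simp only [one_add_jumpTerm]

theorem expFactor_mul (hS : MeasurableSet S) (hβ₁ : IntegrableOn β₁ S g.measure)
    (hβ₂ : IntegrableOn β₂ S g.measure)
    (h : ∀ u ∈ S, β₃ u = β₁ u + β₂ u + β₁ u * β₂ u * (g.jump u : 𝕜)) :
    g.expFactor β₁ S * g.expFactor β₂ S = g.expFactor β₃ S := by
  have h1 : ∀ u, 1 + g.jumpTerm β₃ S u = (1 + g.jumpTerm β₁ S u) * (1 + g.jumpTerm β₂ S u) := by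
    intro u
    by_cases hu : u ∈ S ∩ g.D
    · rw [jumpTerm, jumpTerm, jumpTerm, indicator_of_mem hu, indicator_of_mem hu,
        indicator_of_mem hu, h u hu.1]
      ring
    · simp [jumpTerm, hu]
  have h2 : ∫ u in S \ g.D, β₃ u ∂g.measure
      = (∫ u in S \ g.D, β₁ u ∂g.measure) + ∫ u in S \ g.D, β₂ u ∂g.measure := by
    rw [← integral_add (hβ₁.mono_set sdiff_subset) (hβ₂.mono_set sdiff_subset)]
    refine setIntegral_congr_fun (hS.diff g.measurableSet_D) fun u hu => ?_
    simp [h u hu.1, jump_eq_zero hu.2]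
  simp only [expFactor, h1]
  rw [(multipliable_jumpTerm hβ₁).tprod_mul (multipliable_jumpTerm hβ₂), h2, scalarExp_add]
  ring

theorem expFactor_zero (h : ∀ u ∈ S, β u = 0) : g.expFactor β S = 1 := by
  have h1 : ∀ u, g.jumpTerm β S u = 0 := by
    intro u
    by_cases hu : u ∈ S ∩ g.D
    · rw [jumpTerm, indicator_of_mem hu, h u hu.1, zero_mul]
    · rw [jumpTerm, indicator_of_notMem hu]
  have h2 : ∫ u in S \ g.D, β u ∂g.measure = 0 :=
    setIntegral_eq_zero_of_forall_eq_zero fun u hu => h u hu.1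
  simp [expFactor, h1, h2, scalarExp_zero]

theorem jumpTerm_of_mem {u : ℝ} (hu : u ∈ S) : g.jumpTerm β S u = β u * (g.jump u : 𝕜) := by
  by_cases hD : u ∈ g.D
  · exact indicator_of_mem (s := S ∩ g.D) ⟨hu, hD⟩ _
  · rw [jumpTerm, indicator_of_notMem fun h => hD h.2, jump_eq_zero hD, RCLike.ofReal_zero, mul_zero]

theorem aestronglyMeasurable_jump {μ : Measure ℝ} :
    AEStronglyMeasurable (fun t => (g.jump t : 𝕜)) μ :=
  (RCLike.measurable_ofReal.comp g.measurable_jump).aestronglyMeasurable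

/-- β₂Δ⁺g is bounded on S: each of its norms is at most the sum of all of them, which is finite. -/
theorem integrableOn_mul_mul_jump (hS : MeasurableSet S) (hβ₁ : IntegrableOn β₁ S g.measure)
    (hβ₂ : IntegrableOn β₂ S g.measure) :
    IntegrableOn (fun u => β₁ u * β₂ u * (g.jump u : 𝕜)) S g.measure := by
  simp only [mul_assoc]
  refine Integrable.mul_bdd (c := ∫ u in S ∩ g.D, ‖β₂ u‖ ∂g.measure) hβ₁
    (hβ₂.aestronglyMeasurable.mul aestronglyMeasurable_jump) ?_
  filter_upwards [ae_restrict_mem hS] with u hu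
  rw [← jumpTerm_of_mem (S := S) hu]
  exact le_hasSum (hasSum_norm_jumpTerm hβ₂) u fun _ _ => norm_nonneg _

theorem IsExp.conj {v : ℝ → 𝕜} (hv : g.IsExp T β v) :
    g.IsExp T (fun s => (starRingEnd 𝕜) (β s)) (fun s => (starRingEnd 𝕜) (v s)) := by
  refine ⟨hv.absCont.conj, by simp [hv.init], ?_⟩
  filter_upwards [hv.deriv] with t ht
  refine ⟨ht.1, ?_⟩
  have := (RCLike.continuous_conj.tendsto _).comp ht.2
  rw [map_mul] at this
  refine this.congr fun s => ?_
  simp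

theorem p_zero (t : ℝ) : g.p 0 β t = 0 := by simp [p]

theorem one_add_p_mul_jump (n : ℕ) (t : ℝ) :
    1 + g.p n β t * (g.jump t : 𝕜) = (1 + β t * (g.jump t : 𝕜)) ^ n := by
  rcases n with _ | n
  · simp [p]
  rw [add_comm (1 : 𝕜) (β t * _), add_pow, Finset.range_eq_Ico,
    Finset.sum_eq_sum_Ico_succ_bot (by omega), Finset.sum_eq_sum_Ico_succ_bot (by omega), p, add_mul,
    Finset.sum_mul]
  have h1 : Finset.Ico (0 + 1 + 1) (n + 1 + 1) = Finset.Icc 2 (n + 1) := by ext; simp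
  rw [h1]
  refine congrArg₂ (· + ·) (by simp) (congrArg₂ (· + ·) (by simp; ring) ?_)
  · refine Finset.sum_congr rfl fun k hk => ?_
    obtain ⟨m, rfl⟩ : ∃ m, k = m + 1 := ⟨k - 1, by have := (Finset.mem_Icc.1 hk).1; omega⟩
    rw [Nat.add_sub_cancel]
    ring

/-- At a jump, cancel Δ⁺g in (1 + βΔ⁺g)^(n+1) = (1 + βΔ⁺g)^n (1 + βΔ⁺g); elsewhere p_n(β) = nβ. The
recursion reduces powers to the product law. -/
theorem p_succ (n : ℕ) (t : ℝ) : g.p (n + 1) β t =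
    g.p n β t + β t + g.p n β t * β t * (g.jump t : 𝕜) := by
  by_cases hj : (g.jump t : 𝕜) = 0
  · have h1 : ∀ m : ℕ, g.p m β t = m * β t := by
      intro m
      rw [p, add_eq_left]
      refine Finset.sum_eq_zero fun k hk => ?_
      have := (Finset.mem_Icc.1 hk).1
      rw [hj, zero_pow (by omega), mul_zero]
    rw [h1, h1, hj]; push_cast; ring
  · refine mul_right_cancel₀ hj ?_
    have h1 := one_add_p_mul_jump (g := g) (β := β) (n + 1) t
    have h2 := one_add_p_mul_jump (g := g) (β := β) n t
    rw [pow_succ, ← h2] at h1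
    linear_combination h1

theorem integrableOn_p (hS : MeasurableSet S) (hβ : IntegrableOn β S g.measure) (n : ℕ) :
    IntegrableOn (g.p n β) S g.measure := by
  induction n with
  | zero =>
    have : g.p 0 β = fun _ => 0 := funext p_zero
    rw [this]; exact integrableOn_zero
  | succ n ih =>
    have : g.p (n + 1) β = fun t => g.p n β t + β t + g.p n β t * β t * (g.jump t : 𝕜) :=
      funext (p_succ n)
    rw [this]
    exact (ih.add hβ).add (integrableOn_mul_mul_jump hS ih hβ)

theorem expFactor_pow (hS : MeasurableSet S) (hβ : IntegrableOn β S g.measure) (n : ℕ) :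
    g.expFactor β S ^ n = g.expFactor (g.p n β) S := by
  induction n with
  | zero => rw [pow_zero, expFactor_zero fun u _ => p_zero u]
  | succ n ih =>
    rw [pow_succ, ih]
    exact expFactor_mul hS (integrableOn_p hS hβ n) hβ fun u _ => p_succ n u

theorem finite_half_le_norm_jumpTerm (hβ : IntegrableOn β S g.measure) :
    {u | 1 / 2 ≤ ‖g.jumpTerm β S u‖}.Finite := by
  have h := (hasSum_norm_jumpTerm hβ).summable.tendsto_cofinite_zero.eventually
    (gt_mem_nhds (one_half_pos (α := ℝ)))
  simpa [eventually_cofinite, not_lt] using h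

theorem finite_zeroSet (hβ : IntegrableOn β (Ico 0 T) g.measure) : (g.zeroSet T β).Finite := by
  refine (finite_half_le_norm_jumpTerm hβ).subset ?_
  rintro u ⟨hu, h0⟩
  have h1 : g.jumpTerm β (Ico 0 T) u = -1 := by
    rw [jumpTerm_of_mem hu.1]; linear_combination h0
  show 1 / 2 ≤ ‖g.jumpTerm β (Ico 0 T) u‖
  rw [h1, norm_neg, norm_one]; norm_num

theorem firstZero_mem (hβ : IntegrableOn β (Ico 0 T) g.measure) (h : (g.zeroSet T β).Nonempty) :
    g.firstZero T β ∈ g.zeroSet T β := by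
  rw [firstZero, if_pos h]
  exact h.csInf_mem (finite_zeroSet hβ)

/-- Continuity of g at 0 excludes a zero factor there, so the interval for q_n has positive length.
-/
theorem firstZero_pos_le (hgc : ContinuousAt g 0) (hT : 0 < T)
    (hβ : IntegrableOn β (Ico 0 T) g.measure) : 0 < g.firstZero T β ∧ g.firstZero T β ≤ T := by
  by_cases h : (g.zeroSet T β).Nonempty
  · have h1 := (firstZero_mem hβ h).1
    refine ⟨h1.1.1.lt_of_ne fun h2 => ?_, h1.1.2.le⟩
    exact g.notMem_D_of_continuousAt hgc (h2 ▸ h1.2)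
  · rw [firstZero, if_neg h]; exact ⟨hT, le_rfl⟩

theorem one_add_ne_zero_of_lt_firstZero (hβ : IntegrableOn β (Ico 0 T) g.measure) {u : ℝ}
    (hu : u ∈ Ico 0 (g.firstZero T β)) (huT : u < T) : 1 + β u * (g.jump u : 𝕜) ≠ 0 := by
  intro h0
  by_cases hD : u ∈ g.D
  · have hmem : u ∈ g.zeroSet T β := ⟨⟨⟨hu.1, huT⟩, hD⟩, h0⟩
    have h1 : g.firstZero T β ≤ u := by
      rw [firstZero, if_pos ⟨u, hmem⟩]
      exact csInf_le (finite_zeroSet hβ).bddBelow hmem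
    exact absurd hu.2 (not_lt.2 h1)
  · simp [jump_eq_zero hD] at h0

/-- Summability leaves only finitely many jumps with |βΔ⁺g| ≥ 1/2; elsewhere |1 + βΔ⁺g| ≥ 1/2. -/
theorem exists_pos_le_norm_one_add (hβ : IntegrableOn β S g.measure)
    (h : ∀ u ∈ S, 1 + β u * (g.jump u : 𝕜) ≠ 0) :
    ∃ c : ℝ, 0 < c ∧ ∀ u ∈ S, c ≤ ‖1 + β u * (g.jump u : 𝕜)‖ := by
  set F := {u | 1 / 2 ≤ ‖g.jumpTerm β S u‖} ∩ S
  have hF : F.Finite := (finite_half_le_norm_jumpTerm hβ).inter_of_left S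
  obtain ⟨c, hc, hmin⟩ := Set.exists_min_image
    (insert (1 / 2 : ℝ) ((fun u => ‖1 + β u * (g.jump u : 𝕜)‖) '' F)) id
    ((hF.image _).insert _) (insert_nonempty _ _)
  refine ⟨c, ?_, fun u hu => ?_⟩
  · rcases hc with rfl | ⟨u, hu, rfl⟩
    · norm_num
    · exact norm_pos_iff.2 (h u hu.2)
  · by_cases hu2 : 1 / 2 ≤ ‖g.jumpTerm β S u‖
    · exact hmin _ (.inr ⟨u, ⟨hu2, hu⟩, rfl⟩)
    · have h1 : c ≤ 1 / 2 := hmin _ (.inl rfl)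
      rw [jumpTerm_of_mem hu] at hu2
      have h2 := norm_sub_le_norm_add (1 : 𝕜) (β u * (g.jump u : 𝕜))
      rw [norm_one] at h2
      linarith

/-- The denominator is (1 + βΔ⁺g)^n, so its inverse is bounded by c^(-n). -/
theorem integrableOn_q (hS : MeasurableSet S) (hβ : IntegrableOn β S g.measure)
    (h : ∀ u ∈ S, 1 + β u * (g.jump u : 𝕜) ≠ 0) (n : ℕ) :
    IntegrableOn (g.q n β) S g.measure := by
  obtain ⟨c, hc, hcle⟩ := exists_pos_le_norm_one_add hβ h
  have hp := integrableOn_p hS hβ n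
  have hm : AEStronglyMeasurable (fun t => (1 + g.p n β t * (g.jump t : 𝕜))⁻¹)
      (g.measure.restrict S) :=
    ((aestronglyMeasurable_const.add
      (hp.aestronglyMeasurable.mul aestronglyMeasurable_jump)).aemeasurable.inv).aestronglyMeasurable
  have h1 : g.q n β = fun t => -g.p n β t * (1 + g.p n β t * (g.jump t : 𝕜))⁻¹ :=
    funext fun t => div_eq_mul_inv _ _
  rw [h1]
  refine Integrable.mul_bdd (c := (c ^ n)⁻¹) hp.neg hm ?_
  filter_upwards [ae_restrict_mem hS] with u hu
  rw [one_add_p_mul_jump, norm_inv, norm_pow]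
  exact inv_anti₀ (pow_pos hc n) (pow_le_pow_left₀ hc.le (hcle u hu) n)

theorem expFactor_pow_mul_expFactor_q (hS : MeasurableSet S) (hβ : IntegrableOn β S g.measure)
    (h : ∀ u ∈ S, 1 + β u * (g.jump u : 𝕜) ≠ 0) (n : ℕ) :
    g.expFactor β S ^ n * g.expFactor (g.q n β) S = 1 := by
  rw [expFactor_pow hS hβ, ← expFactor_zero (g := g) (β := fun _ => (0 : 𝕜)) fun u _ => rfl]
  refine expFactor_mul hS (integrableOn_p hS hβ n) (integrableOn_q hS hβ h n) fun u hu => ?_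
  have h1 : 1 + g.p n β u * (g.jump u : 𝕜) ≠ 0 := by
    rw [one_add_p_mul_jump]; exact pow_ne_zero _ (h u hu)
  rw [q]
  field_simp
  ring

theorem expFactor_eq_zero {u : ℝ} (hu : u ∈ S ∩ g.D) (h0 : 1 + β u * (g.jump u : 𝕜) = 0) :
    g.expFactor β S = 0 := by
  rw [expFactor, tprod_of_exists_eq_zero ⟨u, by rw [jumpTerm_of_mem hu.1, h0]⟩, zero_mul]

end Derivator

/-! ### The main theorem -/

theorem mainTheorem6 {𝕜 : Type*} [RCLike 𝕜] (g : Derivator) (hg0 : g 0 = 0)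
    (hgc : ContinuousAt g 0) (T : ℝ) (hT : 0 < T) (β : ℝ → 𝕜)
    (hβ : IntegrableOn β (Ico 0 T) g.measure) :
    -- `exp_g(β; 0, ·)` is the unique solution of its initial value problem
    (g.IsExp T β (g.exp T β) ∧ ∀ v : ℝ → 𝕜, g.IsExp T β v → EqOn v (g.exp T β) (Icc 0 T)) ∧
    -- 1. explicit formula
    (∀ t ∈ Icc 0 T,
      IntegrableOn (fun x => RCLike.re (β (g.pseudoInv T x))) (Ico 0 (g.contPart t)) ∧
      IntegrableOn (fun x => RCLike.im (β (g.pseudoInv T x))) (Ico 0 (g.contPart t)) ∧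
      Multipliable (fun u : ↥(Ico 0 t ∩ g.D) =>
        (1 : 𝕜) + (RCLike.re (β u) : 𝕜) * (g.jump u : 𝕜)
          + RCLike.I * (RCLike.im (β u) : 𝕜) * (g.jump u : 𝕜)) ∧
      g.exp T β t =
        (∏' u : ↥(Ico 0 t ∩ g.D), ((1 : 𝕜) + (RCLike.re (β u) : 𝕜) * (g.jump u : 𝕜)
          + RCLike.I * (RCLike.im (β u) : 𝕜) * (g.jump u : 𝕜))) *
        (Real.exp (∫ x in Ico 0 (g.contPart t), RCLike.re (β (g.pseudoInv T x))) : 𝕜) *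
        ((Real.cos (∫ x in Ico 0 (g.contPart t), RCLike.im (β (g.pseudoInv T x))) : 𝕜) +
          RCLike.I *
            (Real.sin (∫ x in Ico 0 (g.contPart t), RCLike.im (β (g.pseudoInv T x))) : 𝕜))) ∧
    -- 2. conjugation
    (∀ t ∈ Icc 0 T, (starRingEnd 𝕜) (g.exp T β t) =
      g.exp T (fun s => (starRingEnd 𝕜) (β s)) t) ∧
    -- 3. positive powers
    (∀ n : ℕ, 2 ≤ n →
      IntegrableOn (g.p n β) (Ico 0 T) g.measure ∧
      g.AbsCont 0 T (g.exp T (g.p n β)) ∧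
      ∀ t ∈ Icc 0 T, g.exp T β t ^ n = g.exp T (g.p n β) t) ∧
    -- 4. negative powers, up to the first zero factor, after which the exponential vanishes
    (∀ n : ℕ, 2 ≤ n →
      IntegrableOn (g.q n β) (Ico 0 (g.firstZero T β)) g.measure ∧
      g.AbsCont 0 (g.firstZero T β) (g.exp (g.firstZero T β) (g.q n β)) ∧
      ∀ t ∈ Icc 0 (g.firstZero T β), g.exp T β t ≠ 0 ∧
        g.exp T β t ^ (-(n : ℤ)) = g.exp (g.firstZero T β) (g.q n β) t) ∧
    (∀ t ∈ Ioc (g.firstZero T β) T, g.exp T β t = 0) ∧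
    -- 5. product law
    (∀ β₁ β₂ : ℝ → 𝕜, IntegrableOn β₁ (Ico 0 T) g.measure →
      IntegrableOn β₂ (Ico 0 T) g.measure →
      IntegrableOn (fun s => β₁ s * β₂ s * (g.jump s : 𝕜)) (Ico 0 T) g.measure →
      ∀ t ∈ Icc 0 T, g.exp T β₁ t * g.exp T β₂ t =
        g.exp T (fun s => β₁ s + β₂ s + β₁ s * β₂ s * (g.jump s : 𝕜)) t) := by
  have hE := fun (t : ℝ) (ht : t ∈ Icc 0 T) => Derivator.exp_eq_expFactor hg0 hT hβ ht
  have hsub : ∀ t ∈ Icc 0 T, IntegrableOn β (Ico 0 t) g.measure :=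
    fun t ht => hβ.mono_set (Ico_subset_Ico_right ht.2)
  refine ⟨⟨Derivator.isExp_exp hg0 hT hβ,
    fun v hv => hv.eqOn hg0 hT hβ (Derivator.isExp_exp hg0 hT hβ)⟩, ?_, ?_, ?_, ?_, ?_, ?_⟩
  · intro t ht
    obtain ⟨h1, h2⟩ := Derivator.integrableOn_comp_pseudoInv
      (f := fun u => RCLike.re (β u)) hg0 hβ.re ht
    obtain ⟨h3, h4⟩ := Derivator.integrableOn_comp_pseudoInv
      (f := fun u => RCLike.im (β u)) hg0 hβ.im ht
    have hterm : ∀ u : ℝ, (1 : 𝕜) + (RCLike.re (β u) : 𝕜) * (g.jump u : 𝕜)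
        + RCLike.I * (RCLike.im (β u) : 𝕜) * (g.jump u : 𝕜) = 1 + β u * (g.jump u : 𝕜) := by
      intro u
      conv_rhs => rw [← RCLike.re_add_im (β u)]
      ring
    have hint : IntegrableOn β (Ico 0 t \ g.D) g.measure := (hsub t ht).mono_set sdiff_subset
    refine ⟨h1, h3, ?_, ?_⟩
    · simp only [hterm]
      exact Derivator.multipliable_subtype_jump (hsub t ht)
    · simp only [hterm]
      rw [hE t ht, Derivator.expFactor_eq_tprod_subtype, Derivator.scalarExp, mul_assoc, h2, h4,
        integral_re hint, integral_im hint]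
  · intro t ht
    have hc : IntegrableOn (fun s => (starRingEnd 𝕜) (β s)) (Ico 0 T) g.measure :=
      (RCLike.conjCLE (K := 𝕜)).toContinuousLinearMap.integrable_comp hβ
    exact (Derivator.isExp_exp hg0 hT hβ).conj.eqOn hg0 hT hc (Derivator.isExp_exp hg0 hT hc) ht
  · intro n _
    have hp := Derivator.integrableOn_p (g := g) measurableSet_Ico hβ n
    refine ⟨hp, (Derivator.isExp_exp hg0 hT hp).absCont, fun t ht => ?_⟩
    rw [hE t ht, Derivator.exp_eq_expFactor hg0 hT hp ht,
      Derivator.expFactor_pow measurableSet_Ico (hsub t ht)]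
  · intro n _
    obtain ⟨hz, hzT⟩ := Derivator.firstZero_pos_le hgc hT hβ
    have hne : ∀ u ∈ Ico 0 (g.firstZero T β), 1 + β u * (g.jump u : 𝕜) ≠ 0 := fun u hu =>
      Derivator.one_add_ne_zero_of_lt_firstZero hβ hu (hu.2.trans_le hzT)
    have hq := Derivator.integrableOn_q measurableSet_Ico
      (hβ.mono_set (Ico_subset_Ico_right hzT)) hne n
    refine ⟨hq, (Derivator.isExp_exp hg0 hz hq).absCont, fun t ht => ?_⟩
    have htT : t ∈ Icc 0 T := ⟨ht.1, ht.2.trans hzT⟩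
    have hmul := fun m => Derivator.expFactor_pow_mul_expFactor_q measurableSet_Ico (hsub t htT)
      (fun u hu => hne u ⟨hu.1, hu.2.trans_le ht.2⟩) m
    -- The case n = 1 exhibits an inverse of the exponential, hence its nonvanishing.
    have h1 := hmul 1
    rw [pow_one] at h1
    rw [hE t htT, Derivator.exp_eq_expFactor hg0 hz hq ht]
    refine ⟨left_ne_zero_of_mul_eq_one h1, ?_⟩
    rw [zpow_neg, zpow_natCast]
    exact inv_eq_of_mul_eq_one_right (hmul n)
  · intro t ht
    have hz := (Derivator.firstZero_pos_le hgc hT hβ).1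
    by_cases h : (g.zeroSet T β).Nonempty
    · obtain ⟨⟨hm1, hm2⟩, hm3⟩ := Derivator.firstZero_mem hβ h
      rw [hE t ⟨hz.le.trans ht.1.le, ht.2⟩]
      exact Derivator.expFactor_eq_zero ⟨⟨hm1.1, ht.1⟩, hm2⟩ hm3
    · rw [Derivator.firstZero, if_neg h] at ht
      exact absurd ht.1 (not_lt.2 ht.2)
  · intro β₁ β₂ h₁ h₂ h₃ t ht
    have h4 : IntegrableOn (fun s => β₁ s + β₂ s + β₁ s * β₂ s * (g.jump s : 𝕜)) (Ico 0 T)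
      g.measure := (h₁.add h₂).add h₃
    rw [Derivator.exp_eq_expFactor hg0 hT h₁ ht, Derivator.exp_eq_expFactor hg0 hT h₂ ht,
      Derivator.exp_eq_expFactor hg0 hT h4 ht]
    exact Derivator.expFactor_mul measurableSet_Ico (h₁.mono_set (Ico_subset_Ico_right ht.2))
      (h₂.mono_set (Ico_subset_Ico_right ht.2)) fun u _ => rfl
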